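/- Convex polytopes are infinitesimally rigid. Let $P\subset\mathbb R^3$ be a convex polytope, that is, the convex hull of finitely many points, with non-empty interior, and let $V$ be its set of vertices. Triangulate the non-triangular faces of $P$ by diagonals in an arbitrary way, that is, let $T$ be any triangulation of the boundary surface $\partial P$ by straight triangles whose vertex set is $V$. Let $(v_p)_{p\in V}$ be vectors in $\mathbb R^3$ such that for every edge $pq$ of $T$ (an edge of $P$ or one of the diagonals) $$\left.\frac{d}{dt}\right|_{t=0}\bigl\|(p+t\,v_p)-(q+t\,v_q)\bigr\|=0 .$$ Then $(v_p)$ is trivial: it is the restriction to $V$ of an infinitesimal rigid motion of $\mathbb R^3$. That is, there are a family of isometries $g_t$ $(t\in\mathbb R)$ of $\mathbb R^3$ with $g_0=\mathrm{id}$ and a vector field $X$ on $\mathbb R^3$ such that $\left.\frac{d}{dt}\right|_{t=0}g_t(x)=X(x)$ for every $x\in\mathbb R^3$, and $v_p=X(p)$ for all $p\in V$. -/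

import Mathlib

namespace PolytopeRigidity

/-- Euclidean three-space. -/
abbrev E3 : Type := EuclideanSpace ℝ (Fin 3)

/-- A (three-dimensional) convex polytope: the convex hull of a finite set of points, with
non-empty interior. Its vertices are its extreme points, `P.extremePoints ℝ`. -/
def IsConvexPolytope (P : Set E3) : Prop :=
  (∃ S : Finset E3, P = convexHull ℝ (S : Set E3)) ∧ (interior P).Nonempty

/-- `K` arises from the boundary of `P` by triangulating the non-triangular faces by diagonals,
that is, `K` is a simplicial complex that subdivides the boundary surface of `P` without new
vertices. (A simplex inside the boundary of a convex body lies in a single face, so every edge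
of `K` is an edge of `P` or a diagonal of a face of `P`, and triangular faces are not divided.) -/
def IsBoundaryTriangulation (K : Geometry.SimplicialComplex ℝ E3) (P : Set E3) : Prop :=
  K.vertices = P.extremePoints ℝ ∧ K.space = frontier P

/-- The points `p` and `q` are the two endpoints of an edge of the complex `K`. -/
def IsEdge (K : Geometry.SimplicialComplex ℝ E3) (p q : E3) : Prop :=
  p ≠ q ∧ ∃ s ∈ K.faces, (s : Set E3) = {p, q}

/-- An infinitesimal motion `v` of the points of `V` (moving `p` to `p + t • v p`) is a first-order
flex of the edges of `K` if the first-order variation of the length of every edge is zero. -/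
def IsFirstOrderFlex (K : Geometry.SimplicialComplex ℝ E3) (V : Set E3) (v : V → E3) : Prop :=
  ∀ p q : V, IsEdge K p q →
    HasDerivAt (fun t : ℝ => dist ((p : E3) + t • v p) ((q : E3) + t • v q)) 0 0

/-- A vector field on space is an infinitesimal rigid motion if it is the velocity field at time
`0` of a family of rigid motions (isometries of space) that starts at the identity. -/
def IsInfinitesimalRigidMotion (X : E3 → E3) : Prop :=
  ∃ g : ℝ → (E3 ≃ᵃⁱ[ℝ] E3), g 0 = AffineIsometryEquiv.refl ℝ E3 ∧
    ∀ x : E3, HasDerivAt (fun t : ℝ => g t x) (X x) 0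

/-- An infinitesimal motion of the points of `V` is trivial if it is the restriction of an
infinitesimal rigid motion of space. -/
def IsTrivialMotion (V : Set E3) (v : V → E3) : Prop :=
  ∃ X : E3 → E3, IsInfinitesimalRigidMotion X ∧ ∀ p : V, v p = X p

end PolytopeRigidity

/-! Put the origin at an interior point of the polytope. A flex `w` moves each triangle by a field
`z ↦ ω × z + τ` (`exists_motion`). The two triangles at an edge `vp` agree at both ends, so their
angular velocities differ by a multiple `lam v p` of `x p - x v`. These numbers are symmetric in `v`
and `p`, and around each vertex the jumps cancel: `lam` is an equilibrium stress. The flex is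
trivial once `lam = 0`, because triangles are connected through common edges (`eq_of_adjacent`).

Consider the sum over `v` and its neighbours `p` of `lam v p * ⟨x v, w p - w v⟩`. The two terms of
an edge add up to `-lam v p * ⟨x v - x p, w v - w p⟩ = 0`, so the total is zero. But for each fixed
`v` the sum over `p` is nonpositive, and zero only if the stress vanishes at `v`
(`vertex_form_nonpos`). Hence `lam = 0`.

The vertex inequality is of Minkowski type. Modulo the line of `v`, the functionals `det (v, ω, ·)`
of the triangles at `v` form a piecewise linear function `f` on a plane, and the sum over `p` is a
quadratic form pairing the jumps of `f` with its values. The form is symmetric with linear functions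
in its kernel (`sum_jump_mul`). Convexity provides a positive function `R` on which it is
nonnegative, and equilibrium makes `f` orthogonal to `R`. Subtracting a multiple of `R` and a linear
function makes `f` vanish on a line, and there the form is minus a sum of squares. -/

set_option linter.unusedSectionVars false

namespace PolytopeRigidity

/-! ### Determinants and cross products in coordinates. -/

/-- The determinant of three vectors of space. -/
def det3 (a b c : E3) : ℝ :=
  a 0 * (b 1 * c 2 - b 2 * c 1) - a 1 * (b 0 * c 2 - b 2 * c 0) + a 2 * (b 0 * c 1 - b 1 * c 0)

/-- The determinant as a linear function of the last vector. -/
def det3L (a b : E3) : E3 →ₗ[ℝ] ℝ where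
  toFun c := det3 a b c
  map_add' c d := by simp only [det3, PiLp.add_apply]; ring
  map_smul' r c := by simp only [det3, PiLp.smul_apply, smul_eq_mul, RingHom.id_apply]; ring

@[simp] theorem det3L_apply (a b c : E3) : det3L a b c = det3 a b c := rfl

/-- The cross product of two vectors of space. -/
def cross (a b : E3) : E3 :=
  !₂[a 1 * b 2 - a 2 * b 1, a 2 * b 0 - a 0 * b 2, a 0 * b 1 - a 1 * b 0]

theorem cross_zero_coord (a b : E3) : cross a b 0 = a 1 * b 2 - a 2 * b 1 := rfl
theorem cross_one_coord (a b : E3) : cross a b 1 = a 2 * b 0 - a 0 * b 2 := rfl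
theorem cross_two_coord (a b : E3) : cross a b 2 = a 0 * b 1 - a 1 * b 0 := rfl

theorem ext_coord {a b : E3} (h0 : a 0 = b 0) (h1 : a 1 = b 1) (h2 : a 2 = b 2) : a = b := by
  ext i
  fin_cases i
  exacts [h0, h1, h2]

theorem inner_coord (a b : E3) : inner ℝ a b = a 0 * b 0 + a 1 * b 1 + a 2 * b 2 := by
  simp [PiLp.inner_apply, Fin.sum_univ_three]; ring

theorem cross_add (a b c : E3) : cross a (b + c) = cross a b + cross a c := by
  apply ext_coord <;>
    simp only [PiLp.add_apply, cross_zero_coord, cross_one_coord, cross_two_coord] <;> ring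

theorem cross_sub (a b c : E3) : cross a (b - c) = cross a b - cross a c := by
  apply ext_coord <;>
    simp only [PiLp.sub_apply, cross_zero_coord, cross_one_coord, cross_two_coord] <;> ring

theorem sub_cross (a b c : E3) : cross (a - b) c = cross a c - cross b c := by
  apply ext_coord <;>
    simp only [PiLp.sub_apply, cross_zero_coord, cross_one_coord, cross_two_coord] <;> ring

theorem cross_smul (r : ℝ) (a b : E3) : cross a (r • b) = r • cross a b := by
  apply ext_coord <;>
    simp only [PiLp.smul_apply, smul_eq_mul, cross_zero_coord, cross_one_coord,
      cross_two_coord] <;> ring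

theorem inner_cross (a b c : E3) : inner ℝ a (cross b c) = det3 a b c := by
  simp only [inner_coord, det3, cross_zero_coord, cross_one_coord, cross_two_coord]; ring

theorem det3_rotate (a b c : E3) : det3 a b c = det3 b c a := by simp only [det3]; ring
theorem det3_swap (a b c : E3) : det3 a c b = -det3 a b c := by simp only [det3]; ring
@[simp] theorem det3_self_right (a b : E3) : det3 a b b = 0 := by simp only [det3]; ring
@[simp] theorem det3_self_left (a b : E3) : det3 a a b = 0 := by simp only [det3]; ring
@[simp] theorem det3_self_outer (a b : E3) : det3 a b a = 0 := by simp only [det3]; ring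

/-- The linear relation between four vectors of space. -/
theorem det3_relation (v a b c : E3) :
    det3 v a b • c + det3 v b c • a + det3 v c a • b = det3 a b c • v := by
  apply ext_coord <;> simp only [PiLp.add_apply, PiLp.smul_apply, smul_eq_mul, det3] <;> ring

theorem functional_relation {h : E3 →ₗ[ℝ] ℝ} {v : E3} (hv : h v = 0) (a b c : E3) :
    det3 v a b * h c + det3 v b c * h a + det3 v c a * h b = 0 := by
  have := congrArg h (det3_relation v a b c)
  simpa [hv] using this

/-- Functionals vanishing on a plane form a line; this gives the jump of a piecewise linear function
across a ray as a single number. -/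
theorem functional_eq_mul_det3 {h : E3 →ₗ[ℝ] ℝ} {v b c : E3} (hv : h v = 0) (hb : h b = 0)
    (hD : det3 v b c ≠ 0) (z : E3) : h z = h c / det3 v b c * det3 v b z := by
  have := functional_relation hv b c z
  have h2 := det3_swap v b z
  rw [hb, h2] at this
  field_simp
  linarith

/-! ### The quadratic form of a stress at a vertex. -/

section Vertex

variable {N : Type*} [Fintype N] (σ : Equiv.Perm N) (v : E3) (x : N → E3)

/-- Discrete integration by parts around a vertex: the pairing of the jumps of the piecewise linear
function `f` with `H` is a symmetric bilinear form in the values of `f` and `H`. -/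
theorem sum_jump_mul (y : E3 →ₗ[ℝ] ℝ) (hy : y v = 0) (hyx : ∀ p, y (x p) ≠ 0)
    (hD : ∀ p, 0 < det3 v (x p) (x (σ p))) (f : N → E3 →ₗ[ℝ] ℝ) (lam : N → ℝ)
    (hf : ∀ p, f p v = 0)
    (hlam : ∀ p z, f (σ p) z - f p z = lam (σ p) * det3 v (x (σ p)) z) (H : N → ℝ) :
    ∑ p, lam p * H p = -∑ p, y (x p) * y (x (σ p)) *
      (f (σ p) (x (σ p)) / y (x (σ p)) - f p (x p) / y (x p)) *
      (H (σ p) / y (x (σ p)) - H p / y (x p)) / det3 v (x p) (x (σ p)) := by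
  -- A jump splits into shares of the two sectors at its ray; `G p` is the share of the sector after
  -- the ray `p`. Reindexing by `σ` then collects the two shares of each sector.
  set G : N → ℝ := fun p => H p * (y (x (σ p)) *
    (f (σ p) (x (σ p)) / y (x (σ p)) - f p (x p) / y (x p))) / det3 v (x p) (x (σ p)) with hG
  have key : ∀ p, lam (σ p) * H (σ p) = G (σ p) + H (σ p) * (y (x p) *
      (f p (x p) / y (x p) - f (σ p) (x (σ p)) / y (x (σ p)))) / det3 v (x p) (x (σ p)) := by
    intro p
    have e1 := functional_relation hy (x p) (x (σ p)) (x (σ (σ p)))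
    have e2 := functional_relation (hf (σ p)) (x p) (x (σ p)) (x (σ (σ p)))
    have e3 := hlam p (x p)
    have e4 := hlam (σ p) (x (σ (σ p)))
    rw [det3_self_right, mul_zero] at e4
    have e5 := det3_swap v (x p) (x (σ p))
    rw [e5] at e3
    have d1 := (hD p).ne'
    have d2 := (hD (σ p)).ne'
    have y1 := hyx p
    have y2 := hyx (σ p)
    have y3 := hyx (σ (σ p))
    simp only [hG]
    have e6 : f (σ (σ p)) (x (σ (σ p))) = f (σ p) (x (σ (σ p))) := by linarith
    rw [e6]
    have e7 : f (σ p) (x p) = f p (x p) - lam (σ p) * det3 v (x p) (x (σ p)) := by linarith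
    rw [e7] at e2
    generalize f (σ p) (x (σ (σ p))) = Fc at *
    generalize f (σ p) (x (σ p)) = Fb at *
    generalize f p (x p) = Fa at *
    generalize det3 v (x p) (x (σ p)) = D1 at *
    generalize det3 v (x (σ p)) (x (σ (σ p))) = D2 at *
    generalize det3 v (x (σ (σ p))) (x p) = D3 at *
    generalize y (x (σ (σ p))) = yc at *
    generalize y (x (σ p)) = yb at *
    generalize y (x p) = ya at *
    generalize lam (σ p) = l at *
    field_simp
    linear_combination H (σ p) * (-yb * e2 + Fb * e1)
  have r1 : ∑ p, lam p * H p = ∑ p, lam (σ p) * H (σ p) :=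
    (Equiv.sum_comp σ fun p => lam p * H p).symm
  have r2 : ∑ p, G (σ p) = ∑ p, G p := Equiv.sum_comp σ G
  rw [r1, Finset.sum_congr rfl fun p _ => key p, Finset.sum_add_distrib, r2,
    ← Finset.sum_add_distrib, ← Finset.sum_neg_distrib]
  refine Finset.sum_congr rfl fun p _ => ?_
  have d1 := (hD p).ne'
  have y1 := hyx p
  have y2 := hyx (σ p)
  simp only [hG]
  field_simp
  ring

/-- The discrete Minkowski inequality at a vertex `v` of a convex polytope: the quadratic form of
an equilibrium stress at `v` is negative definite. -/
theorem vertex_form_nonpos (d : E3) (hd : ∀ p, det3 d v (x p) ≠ 0)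
    (hD : ∀ p, 0 < det3 v (x p) (x (σ p))) (f : N → E3 →ₗ[ℝ] ℝ) (lam : N → ℝ)
    (hf : ∀ p, f p v = 0)
    (hlam : ∀ p z, f (σ p) z - f p z = lam (σ p) * det3 v (x (σ p)) z)
    (hclosed : ∑ p, lam p • (x p - v) = 0)
    (A : N → E3 →ₗ[ℝ] ℝ) (hAv : ∀ p, A p v = 1) (hAp : ∀ p, A p (x p) = 1)
    (hAs : ∀ p, A p (x (σ p)) = 1) (hA : ∀ p q, A p (x q) ≤ 1)
    (g : E3 →ₗ[ℝ] ℝ) (hgv : g v < 0) (hg : ∀ p, g v < g (x p))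
    (hup : ∀ p q, 0 < det3 d v (x p) → det3 d v (x (σ p)) < 0 → 0 < det3 d v (x q) →
      det3 d v (x (σ q)) < 0 → p = q)
    (hdown : ∀ p q, det3 d v (x p) < 0 → 0 < det3 d v (x (σ p)) → det3 d v (x q) < 0 →
      0 < det3 d v (x (σ q)) → p = q) :
    ∑ p, lam p * f p (x p) ≤ 0 ∧ (∑ p, lam p * f p (x p) = 0 → ∀ p, lam p = 0) := by
  rcases isEmpty_or_nonempty N with hN | ⟨⟨p₀⟩⟩
  · simp
  -- Modulo `v`, the zero set of `y` is the line of `d`, which passes through no ray `x p`.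
  set y : E3 →ₗ[ℝ] ℝ := det3L d v with hy
  have yv : y v = 0 := by simp [hy]
  have yx : ∀ p, y (x p) ≠ 0 := hd
  have hdp : ∀ p, det3 v (x p) d = y (x p) := fun p => by
    rw [hy, det3L_apply, ← det3_rotate]
  set l : E3 →ₗ[ℝ] ℝ := (y (x p₀))⁻¹ • det3L v (x p₀) with hl
  have lv : l v = 0 := by simp [hl]
  have ld : l d = 1 := by simp [hl, hdp, yx p₀]
  -- Replacing `g` by `R` does not change linear data on the differences `x p - v`, but makes the
  -- functionals vanish at `v`. Since `-g v > 0`, `R` inherits convexity from the supporting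
  -- functionals `A`.
  set R : N → E3 →ₗ[ℝ] ℝ := fun p => g - g v • A p with hR
  have Rv : ∀ p, R p v = 0 := fun p => by simp [hR, hAv]
  have Rp : ∀ p, R p (x p) = g (x p) - g v := fun p => by simp [hR, hAp]
  have Rs : ∀ p, R p (x (σ p)) = g (x (σ p)) - g v := fun p => by simp [hR, hAs]
  set mu : N → ℝ := fun p => -g v * ((1 - A (σ.symm p) (x (σ p))) / det3 v (x p) (x (σ p)))
    with hmu
  have mu_nonneg : ∀ p, 0 ≤ mu p := fun p =>
    mul_nonneg (by linarith) (div_nonneg (by linarith [hA (σ.symm p) (σ p)]) (hD p).le)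
  have Rjump : ∀ p z, R (σ p) z - R p z = mu (σ p) * det3 v (x (σ p)) z := by
    intro p z
    have := functional_eq_mul_det3 (h := A (σ p) - A p) (v := v) (b := x (σ p))
      (c := x (σ (σ p))) (by simp [hAv]) (by simp [hAp, hAs]) (hD _).ne' z
    simp only [LinearMap.sub_apply, hAs] at this
    simp only [hR, hmu, LinearMap.sub_apply, LinearMap.smul_apply, smul_eq_mul,
      Equiv.symm_apply_apply]
    linear_combination (-g v) * this
  have cross_val : ∀ (h : E3 →ₗ[ℝ] ℝ) p, h v = 0 → det3 v (x p) (x (σ p)) * h d =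
      y (x p) * h (x (σ p)) - y (x (σ p)) * h (x p) := by
    intro h p hv
    have := functional_relation hv (x p) (x (σ p)) d
    rw [hdp, det3_swap v (x p) d, hdp] at this
    linarith
  -- A sector crossing `y = 0` contains `d` or `-d` modulo `v`, and there is at most one of each
  -- kind. As `R` is positive on both half-lines, `R p d` has opposite signs in the two sectors, so
  -- the two equations for `c` and `k` are solvable.
  obtain ⟨c, k, hck⟩ : ∃ c k : ℝ, ∀ p, y (x p) * y (x (σ p)) < 0 →
      f p d - c * R p d - k = 0 := by
    have Rup : ∀ p, 0 < y (x p) → y (x (σ p)) < 0 → 0 < R p d := by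
      intro p h1 h2
      have := cross_val (R p) p (Rv p)
      rw [Rp, Rs] at this
      have h3 := mul_pos h1 (sub_pos.2 (hg (σ p)))
      have h4 := mul_neg_of_neg_of_pos h2 (sub_pos.2 (hg p))
      exact pos_of_mul_pos_right (a := det3 v (x p) (x (σ p))) (by linarith) (hD p).le
    have Rdown : ∀ p, y (x p) < 0 → 0 < y (x (σ p)) → R p d < 0 := by
      intro p h1 h2
      have := cross_val (R p) p (Rv p)
      rw [Rp, Rs] at this
      have h3 := mul_neg_of_neg_of_pos h1 (sub_pos.2 (hg (σ p)))
      have h4 := mul_pos h2 (sub_pos.2 (hg p))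
      by_contra hcon
      have := mul_nonneg (hD p).le (not_lt.1 hcon)
      linarith
    by_cases h1 : ∃ p, 0 < y (x p) ∧ y (x (σ p)) < 0
    · obtain ⟨p, hp1, hp2⟩ := h1
      by_cases h2 : ∃ q, y (x q) < 0 ∧ 0 < y (x (σ q))
      · obtain ⟨q, hq1, hq2⟩ := h2
        have hne : R p d - R q d ≠ 0 := by linarith [Rup p hp1 hp2, Rdown q hq1 hq2]
        refine ⟨(f p d - f q d) / (R p d - R q d),
          f p d - (f p d - f q d) / (R p d - R q d) * R p d, fun r hr => ?_⟩
        rcases mul_neg_iff.1 hr with ⟨a, b⟩ | ⟨a, b⟩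
        · rw [hup r p a b hp1 hp2]; ring
        · rw [hdown r q a b hq1 hq2]; field_simp; ring
      · refine ⟨0, f p d, fun r hr => ?_⟩
        rcases mul_neg_iff.1 hr with ⟨a, b⟩ | ⟨a, b⟩
        · rw [hup r p a b hp1 hp2]; ring
        · exact absurd ⟨r, a, b⟩ h2
    · by_cases h2 : ∃ q, y (x q) < 0 ∧ 0 < y (x (σ q))
      · obtain ⟨q, hq1, hq2⟩ := h2
        refine ⟨0, f q d, fun r hr => ?_⟩
        rcases mul_neg_iff.1 hr with ⟨a, b⟩ | ⟨a, b⟩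
        · exact absurd ⟨r, a, b⟩ h1
        · rw [hdown r q a b hq1 hq2]; ring
      · refine ⟨0, 0, fun r hr => ?_⟩
        rcases mul_neg_iff.1 hr with ⟨a, b⟩ | ⟨a, b⟩
        · exact absurd ⟨r, a, b⟩ h1
        · exact absurd ⟨r, a, b⟩ h2
  set f' : N → E3 →ₗ[ℝ] ℝ := fun p => f p - c • R p - k • l with hf'
  set lam' : N → ℝ := fun p => lam p - c * mu p with hlam'
  have f'v : ∀ p, f' p v = 0 := fun p => by simp [hf', hf, Rv, lv]
  have f'jump : ∀ p z, f' (σ p) z - f' p z = lam' (σ p) * det3 v (x (σ p)) z := by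
    intro p z
    simp only [hf', hlam', LinearMap.sub_apply, LinearMap.smul_apply, smul_eq_mul]
    linear_combination hlam p z - c * Rjump p z
  have I := fun H => sum_jump_mul σ v x y yv yx hD f' lam' f'v f'jump H
  have If := fun H => sum_jump_mul σ v x y yv yx hD f lam hf hlam H
  have IR := fun H => sum_jump_mul σ v x y yv yx hD R mu Rv Rjump H
  have Il := fun H => sum_jump_mul σ v x y yv yx hD (fun _ => l) 0 (fun _ => lv) (by simp) H
  have hcl : ∀ h : E3 →ₗ[ℝ] ℝ, ∑ p, lam p * h (x p - v) = 0 := by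
    intro h
    simpa using congrArg h hclosed
  -- Equilibrium gives orthogonality of `f` to `R` and `l`; the mirrored statements `z3` and `z4`
  -- follow from the symmetry of the form.
  have z1 : ∑ p, lam p * R p (x p) = 0 := by
    rw [← hcl g]
    exact Finset.sum_congr rfl fun p _ => by rw [Rp, map_sub]
  have z2 : ∑ p, lam p * l (x p) = 0 := by
    rw [← hcl l]
    exact Finset.sum_congr rfl fun p _ => by rw [map_sub, lv, sub_zero]
  have z3 : ∑ p, mu p * f p (x p) = 0 := by
    rw [← z1, IR, If]
    congr 1
    exact Finset.sum_congr rfl fun p _ => by ring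
  have z4 : ∑ p, mu p * l (x p) = 0 := by
    have h0 := Il fun p => R p (x p)
    simp only [Pi.zero_apply, zero_mul, Finset.sum_const_zero] at h0
    rw [h0, IR]
    congr 1
    exact Finset.sum_congr rfl fun p _ => by ring
  have expand : ∑ p, lam' p * f' p (x p) =
      ∑ p, lam p * f p (x p) + c ^ 2 * ∑ p, mu p * R p (x p) := by
    have : ∀ p, lam' p * f' p (x p) = lam p * f p (x p) + c ^ 2 * (mu p * R p (x p))
        - c * (lam p * R p (x p)) - k * (lam p * l (x p)) - c * (mu p * f p (x p))
        + c * k * (mu p * l (x p)) := fun p => by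
      simp only [hf', hlam', LinearMap.sub_apply, LinearMap.smul_apply, smul_eq_mul]; ring
    simp only [this, Finset.sum_add_distrib, Finset.sum_sub_distrib, ← Finset.mul_sum, z1, z2, z3,
      z4]
    ring
  -- In a crossing sector the increment of `f' / y` is proportional to `f' p d = 0`; in any other
  -- sector both values of `y` have the same sign.
  have term : ∀ p, 0 ≤ y (x p) * y (x (σ p)) *
      (f' (σ p) (x (σ p)) / y (x (σ p)) - f' p (x p) / y (x p)) *
      (f' (σ p) (x (σ p)) / y (x (σ p)) - f' p (x p) / y (x p)) / det3 v (x p) (x (σ p)) := by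
    intro p
    refine div_nonneg ?_ (hD p).le
    rw [mul_assoc]
    rcases lt_or_gt_of_ne (mul_ne_zero (yx p) (yx (σ p))) with hneg | hpos
    · have h1 := cross_val (f' p) p (f'v p)
      have h2 : f' p d = 0 := by
        rw [← hck p hneg]; simp [hf', ld]
      have h3 : f' (σ p) (x (σ p)) = f' p (x (σ p)) := by
        have := f'jump p (x (σ p))
        rw [det3_self_right] at this
        linarith
      rw [h2, mul_zero] at h1
      have h4 : f' (σ p) (x (σ p)) / y (x (σ p)) - f' p (x p) / y (x p) = 0 := by
        rw [h3, div_sub_div _ _ (yx _) (yx _)]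
        rw [show f' p (x (σ p)) * y (x p) - y (x (σ p)) * f' p (x p) = 0 by linarith, zero_div]
      rw [h4]; simp
    · exact mul_nonneg hpos.le (mul_self_nonneg _)
  have muR : ∀ p, 0 ≤ mu p * R p (x p) := fun p =>
    mul_nonneg (mu_nonneg p) (by rw [Rp]; linarith [hg p])
  have S1 : ∑ p, lam' p * f' p (x p) ≤ 0 := by
    rw [I]; exact neg_nonpos.2 (Finset.sum_nonneg fun p _ => term p)
  have S2 : 0 ≤ c ^ 2 * ∑ p, mu p * R p (x p) :=
    mul_nonneg (sq_nonneg c) (Finset.sum_nonneg fun p _ => muR p)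
  refine ⟨by linarith, fun h0 => ?_⟩
  have E1 : ∑ p, lam' p * f' p (x p) = 0 := by linarith
  have E2 : c ^ 2 * ∑ p, mu p * R p (x p) = 0 := by linarith
  have E3' : ∀ p, f' (σ p) (x (σ p)) / y (x (σ p)) - f' p (x p) / y (x p) = 0 := by
    intro p
    rw [I, neg_eq_zero, Finset.sum_eq_zero_iff_of_nonneg fun p _ => term p] at E1
    have := E1 p (Finset.mem_univ p)
    simpa [yx, (hD p).ne'] using this
  -- All increments of `f' / y` vanish, so `f'` pairs to zero with every `H`; the choice `H = lam'`
  -- gives a sum of squares.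
  have E4 : ∀ p, lam' p = 0 := by
    have := I lam'
    simp only [E3', mul_zero, zero_mul, zero_div, Finset.sum_const_zero, neg_zero] at this
    rw [Finset.sum_eq_zero_iff_of_nonneg fun p _ => mul_self_nonneg _] at this
    exact fun p => mul_self_eq_zero.1 (this p (Finset.mem_univ p))
  have E5 : ∀ p, c * mu p = 0 := by
    rcases mul_eq_zero.1 E2 with h | h
    · intro p; rw [pow_eq_zero_iff two_ne_zero] at h; rw [h, zero_mul]
    · rw [Finset.sum_eq_zero_iff_of_nonneg fun p _ => muR p] at h
      intro p
      rcases mul_eq_zero.1 (h p (Finset.mem_univ p)) with h | h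
      · rw [h, mul_zero]
      · rw [Rp] at h; linarith [hg p]
  intro p
  have := E4 p
  simp only [hlam'] at this
  linarith [E5 p]

end Vertex

/-! ### Complete simplicial fans. -/

section Fan

variable {ι : Type*} [Fintype ι] [DecidableEq ι]

/-- The relatively open cone spanned by the points `x p`, `p ∈ s`. -/
def OpenCone (x : ι → E3) (s : Finset ι) : Set E3 :=
  {z | ∃ c : ι → ℝ, (∀ p ∈ s, 0 < c p) ∧ ∑ p ∈ s, c p • x p = z}

/-- The closed cone spanned by the points `x p`, `p ∈ s`. -/
def ClosedCone (x : ι → E3) (s : Finset ι) : Set E3 :=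
  {z | ∃ c : ι → ℝ, (∀ p ∈ s, 0 ≤ c p) ∧ ∑ p ∈ s, c p • x p = z}

/-- The faces `𝒮` span the cones of a complete simplicial fan and subdivide the boundary of a convex
polytope with vertices `x p` that contains the origin in its interior. -/
structure IsConvexFan (x : ι → E3) (𝒮 : Set (Finset ι)) : Prop where
  nonempty : ∀ s ∈ 𝒮, s.Nonempty
  down : ∀ s ∈ 𝒮, ∀ t ⊆ s, t.Nonempty → t ∈ 𝒮
  singleton_mem : ∀ p, {p} ∈ 𝒮
  cover : ∀ z : E3, z ≠ 0 → ∃ s ∈ 𝒮, z ∈ OpenCone x s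
  unique : ∀ s ∈ 𝒮, ∀ t ∈ 𝒮, ∀ z ∈ OpenCone x s, z ∈ OpenCone x t → s = t
  support : ∀ s ∈ 𝒮, ∃ A : E3 →ₗ[ℝ] ℝ, (∀ p ∈ s, A (x p) = 1) ∧ ∀ p, A (x p) ≤ 1
  pointed : ∀ v, ∃ g : E3 →ₗ[ℝ] ℝ, g (x v) < 0 ∧ ∀ p, p ≠ v → g (x v) < g (x p)

theorem single_mem_openCone (x : ι → E3) (v : ι) {a : ℝ} (ha : 0 < a) :
    a • x v ∈ OpenCone x {v} :=
  ⟨fun _ => a, fun _ _ => ha, by simp⟩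

theorem pair_mem_openCone (x : ι → E3) {v p : ι} (hvp : v ≠ p) {a b : ℝ} (ha : 0 < a)
    (hb : 0 < b) : a • x v + b • x p ∈ OpenCone x {v, p} := by
  refine ⟨fun i => if i = v then a else b, fun i _ => ?_, ?_⟩
  · dsimp only; split_ifs <;> assumption
  · rw [Finset.sum_pair hvp]; simp [hvp.symm]

theorem sum_triple (h : ι → E3) {v p q : ι} (hvp : v ≠ p) (hvq : v ≠ q) (hpq : p ≠ q) :
    ∑ i ∈ {v, p, q}, h i = h v + h p + h q := by
  rw [Finset.sum_insert (by simp [hvp, hvq]), Finset.sum_pair hpq, add_assoc]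

theorem triple_mem_openCone (x : ι → E3) {v p q : ι} (hvp : v ≠ p) (hvq : v ≠ q) (hpq : p ≠ q)
    {a b c : ℝ} (ha : 0 < a) (hb : 0 < b) (hc : 0 < c) :
    a • x v + b • x p + c • x q ∈ OpenCone x {v, p, q} := by
  refine ⟨fun i => if i = v then a else if i = p then b else c, fun i _ => ?_, ?_⟩
  · dsimp only; split_ifs <;> assumption
  · rw [sum_triple _ hvp hvq hpq]; simp [hvp.symm, hvq.symm, hpq.symm]

theorem cross_eq_zero_relation {a b : E3} (h : cross a b = 0) :
    (-inner ℝ a b : ℝ) • a + (inner ℝ a a : ℝ) • b = 0 := by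
  have h0 := congrArg (fun z : E3 => z 0) h
  have h1 := congrArg (fun z : E3 => z 1) h
  have h2 := congrArg (fun z : E3 => z 2) h
  simp only [cross_zero_coord, cross_one_coord, cross_two_coord, PiLp.zero_apply] at h0 h1 h2
  apply ext_coord <;>
    simp only [PiLp.add_apply, PiLp.smul_apply, smul_eq_mul, inner_coord, PiLp.zero_apply]
  · linear_combination a 2 * h1 - a 1 * h2
  · linear_combination a 0 * h2 - a 2 * h0
  · linear_combination a 1 * h0 - a 0 * h1

theorem exists_cross_ne_zero {a : E3} (ha : a ≠ 0) : ∃ d, cross a d ≠ 0 := by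
  by_contra! hcon
  have h0 := hcon !₂[1, 0, 0]
  have h1 := hcon !₂[0, 1, 0]
  have e1 := congrArg (fun z : E3 => z 1) h0
  have e2 := congrArg (fun z : E3 => z 2) h0
  have e3 := congrArg (fun z : E3 => z 2) h1
  simp [cross_one_coord, cross_two_coord] at e1 e2 e3
  exact ha (ext_coord (by simpa using e3) (by simpa using e2) (by simpa using e1))

/-- Along this curve a functional is a polynomial in `t` whose coefficients are its values on a
basis, so a nonzero functional has finitely many roots. Positivity of `t` keeps the point in the
open cone of `a`, `b`, `c`. -/
theorem exists_generic {a b c : E3} (habc : det3 a b c ≠ 0) {κ : Type*} [Finite κ]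
    (h : κ → E3 →ₗ[ℝ] ℝ) (hh : ∀ i, h i ≠ 0) :
    ∃ t : ℝ, 0 < t ∧ ∀ i, h i (a + t • b + t ^ 2 • c) ≠ 0 := by
  classical
  set P : κ → Polynomial ℝ := fun i => Polynomial.C (h i a) + Polynomial.C (h i b) * Polynomial.X
    + Polynomial.C (h i c) * Polynomial.X ^ 2 with hP
  have Pne : ∀ i, P i ≠ 0 := by
    intro i h0
    have ca := congrArg (fun q => q.coeff 0) h0
    have cb := congrArg (fun q => q.coeff 1) h0
    have cc := congrArg (fun q => q.coeff 2) h0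
    simp [hP, Polynomial.coeff_X, Polynomial.coeff_C, Polynomial.coeff_X_pow] at ca cb cc
    refine hh i (LinearMap.ext fun z => ?_)
    have := functional_relation ca b c z
    rw [cb, cc] at this
    simpa [habc] using this
  have fin : (⋃ i, {t | (P i).IsRoot t}).Finite :=
    Set.finite_iUnion fun i => Polynomial.finite_setOfPred_isRoot (Pne i)
  obtain ⟨t, ht, ht'⟩ := (Set.Ioi_infinite (0 : ℝ)).exists_notMem_finite fin
  refine ⟨t, ht, fun i h0 => ht' (Set.mem_iUnion.2 ⟨i, ?_⟩)⟩
  simp only [hP, Set.mem_ofPred_eq, Polynomial.IsRoot.def, Polynomial.eval_add, Polynomial.eval_mul,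
    Polynomial.eval_C, Polynomial.eval_X, Polynomial.eval_pow]
  simp only [map_add, map_smul, smul_eq_mul] at h0
  linarith

namespace IsConvexFan

variable {x : ι → E3} {𝒮 : Set (Finset ι)} (F : IsConvexFan x 𝒮)
include F

theorem zero_notMem {s : Finset ι} (hs : s ∈ 𝒮) : (0 : E3) ∉ OpenCone x s := by
  rintro ⟨c, hc, h0⟩
  obtain ⟨A, hA, -⟩ := F.support s hs
  have := congrArg A h0
  simp only [map_sum, map_smul, smul_eq_mul, map_zero] at this
  rw [Finset.sum_congr rfl fun p hp => by rw [hA p hp, mul_one]] at this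
  exact (Finset.sum_pos hc (F.nonempty s hs)).ne' this

theorem pos_ne_zero (v : ι) : x v ≠ 0 := by
  intro h
  have := single_mem_openCone x v one_pos
  rw [h, smul_zero] at this
  exact F.zero_notMem (F.singleton_mem v) this

theorem exists_subset_of_nonneg {s : Finset ι} (hs : s ∈ 𝒮) {c : ι → ℝ} (hc : ∀ p ∈ s, 0 ≤ c p)
    (h0 : ∑ p ∈ s, c p • x p ≠ 0) :
    {p ∈ s | 0 < c p} ∈ 𝒮 ∧ ∑ p ∈ s, c p • x p ∈ OpenCone x {p ∈ s | 0 < c p} := by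
  have e : ∑ p ∈ s with 0 < c p, c p • x p = ∑ p ∈ s, c p • x p := by
    refine Finset.sum_subset (Finset.filter_subset _ _) fun p hp hp' => ?_
    have : c p = 0 := le_antisymm (not_lt.1 fun h => hp' (Finset.mem_filter.2 ⟨hp, h⟩)) (hc p hp)
    rw [this, zero_smul]
  refine ⟨F.down s hs _ (Finset.filter_subset _ _) ?_, c, fun p hp => (Finset.mem_filter.1 hp).2, e⟩
  by_contra hne
  rw [Finset.not_nonempty_iff_eq_empty.1 hne, Finset.sum_empty] at e
  exact h0 e.symm

/-- The positive and negative parts of a relation represent one point by disjoint subsets of `s`. If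
the point is nonzero this contradicts `unique`; if it is zero, a supporting functional, equal to 1
on all of `s`, kills all coefficients. -/
theorem indep {s : Finset ι} (hs : s ∈ 𝒮) {c : ι → ℝ} (h0 : ∑ p ∈ s, c p • x p = 0) :
    ∀ p ∈ s, c p = 0 := by
  have hsplit : ∑ p ∈ s, max (c p) 0 • x p = ∑ p ∈ s, max (-c p) 0 • x p := by
    rw [← sub_eq_zero, ← Finset.sum_sub_distrib, ← h0]
    refine Finset.sum_congr rfl fun p _ => ?_
    rw [← sub_smul]
    congr 1
    rcases le_total (c p) 0 with h | h
    · rw [max_eq_right h, max_eq_left (by linarith)]; ring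
    · rw [max_eq_left h, max_eq_right (by linarith)]; ring
  by_cases hz : ∑ p ∈ s, max (c p) 0 • x p = 0
  · have aux : ∀ c' : ι → ℝ, (∀ p ∈ s, 0 ≤ c' p) → ∑ p ∈ s, c' p • x p = 0 →
        ∀ p ∈ s, c' p = 0 := by
      intro c' hc' h
      obtain ⟨A, hA, -⟩ := F.support s hs
      have := congrArg A h
      simp only [map_sum, map_smul, smul_eq_mul, map_zero] at this
      rw [Finset.sum_congr rfl fun p hp => by rw [hA p hp, mul_one]] at this
      exact (Finset.sum_eq_zero_iff_of_nonneg hc').1 this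
    intro p hp
    have h1 := aux _ (fun p _ => le_max_right (c p) 0) hz p hp
    have h2 := aux _ (fun p _ => le_max_right (-c p) 0) (hsplit ▸ hz) p hp
    have h3 := le_max_left (c p) 0
    have h4 := le_max_left (-c p) 0
    linarith
  · exfalso
    obtain ⟨m1, h1⟩ := F.exists_subset_of_nonneg hs (fun p _ => le_max_right (c p) 0) hz
    obtain ⟨m2, h2⟩ := F.exists_subset_of_nonneg hs (fun p _ => le_max_right (-c p) 0)
      (hsplit ▸ hz)
    rw [← hsplit] at h2
    have e := F.unique _ m1 _ m2 _ h1 h2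
    obtain ⟨p, hp⟩ := F.nonempty _ m1
    have hp' := e ▸ hp
    have a1 := (Finset.mem_filter.1 hp).2
    have a2 := (Finset.mem_filter.1 hp').2
    rcases lt_max_iff.1 a1 with a1 | a1
    · rcases lt_max_iff.1 a2 with a2 | a2 <;> linarith
    · exact lt_irrefl _ a1

theorem coeff_unique {s : Finset ι} (hs : s ∈ 𝒮) {c c' : ι → ℝ}
    (h : ∑ p ∈ s, c p • x p = ∑ p ∈ s, c' p • x p) : ∀ p ∈ s, c p = c' p := by
  intro p hp
  refine sub_eq_zero.1 (F.indep hs (c := fun p => c p - c' p) ?_ p hp)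
  simp only [sub_smul, Finset.sum_sub_distrib, h, sub_self]

theorem card_le {s : Finset ι} (hs : s ∈ 𝒮) : s.card ≤ 3 := by
  have h : LinearIndepOn ℝ x (s : Set ι) :=
    linearIndepOn_finset_iff.2 fun c hc => F.indep hs hc
  have := h.linearIndependent.fintype_card_le_finrank
  simpa using this

theorem cross_ne_zero {v p : ι} (hvp : v ≠ p) (hs : {v, p} ∈ 𝒮) : cross (x v) (x p) ≠ 0 := by
  intro h
  have h1 := cross_eq_zero_relation h
  have h2 := F.indep hs (c := fun i => if i = v then -inner ℝ (x v) (x p) else inner ℝ (x v) (x v))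
    (by rw [Finset.sum_pair hvp]; simpa [hvp.symm] using h1) p (by simp)
  rw [if_neg hvp.symm, inner_self_eq_zero] at h2
  exact F.pos_ne_zero v h2

theorem det3_ne_zero {v p q : ι} (hvp : v ≠ p) (hvq : v ≠ q) (hpq : p ≠ q)
    (hs : {v, p, q} ∈ 𝒮) : det3 (x v) (x p) (x q) ≠ 0 := by
  intro h
  refine F.cross_ne_zero hpq (F.down _ hs {p, q} (by simp) (by simp)) ?_
  have key : ∀ c, det3 (x p) (x q) c = 0 := by
    intro c
    have h1 := det3_relation (x v) (x p) (x q) c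
    rw [h, zero_smul, zero_add] at h1
    have h2 := F.indep hs (c := fun i => if i = v then -det3 (x p) (x q) c
      else if i = p then det3 (x v) (x q) c else det3 (x v) c (x p))
      (by rw [sum_triple _ hvp hvq hpq]
          simp only [if_true, if_neg hvp.symm, if_neg hvq.symm, if_neg hpq.symm]
          rw [neg_smul, ← h1]; abel) v (by simp)
    simpa using h2
  rw [← inner_self_eq_zero (𝕜 := ℝ), inner_cross, det3_rotate]
  exact key _

/-- The faces near a point in the relative interior of a face contain this face. -/
theorem exists_face_near {e : Finset ι} (he : e ∈ 𝒮) {z : E3} (hz : z ∈ OpenCone x e) (d : E3) :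
    ∃ s ∈ 𝒮, e ⊆ s ∧ ∃ n : ℕ, (n : ℝ) • z + d ∈ OpenCone x s := by
  by_cases hall : ∃ n : ℕ, (n : ℝ) • z + d = 0
  · obtain ⟨n, hn⟩ := hall
    refine ⟨e, he, subset_rfl, n + 1, ?_⟩
    have : ((n + 1 : ℕ) : ℝ) • z + d = z := by
      push_cast
      rw [add_smul, one_smul, add_right_comm, hn, zero_add]
    rwa [this]
  push Not at hall
  choose S hS hmem using fun n => F.cover _ (hall n)
  choose c hc hsum using hmem
  -- One cone contains `n • z + d` for infinitely many `n`. Its coefficients there are affine in `n`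
  -- and positive for arbitrarily large `n`, so the slopes `a` are nonnegative; they represent `z`,
  -- and `unique` places `e` inside `s`.
  obtain ⟨s, hinf⟩ := Finite.exists_infinite_fiber S
  have hinf : (S ⁻¹' {s}).Infinite := Set.infinite_coe_iff.1 hinf
  obtain ⟨m, hm : S m = s⟩ := hinf.nonempty
  obtain ⟨n, hn : S n = s, hmn⟩ := hinf.exists_gt m
  have hs : s ∈ 𝒮 := hm ▸ hS m
  have hmn' : ((n : ℝ) - m) ≠ 0 := sub_ne_zero.2 (by exact_mod_cast hmn.ne')
  set a : ι → ℝ := fun p => ((n : ℝ) - m)⁻¹ * (c n p - c m p) with ha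
  have hsm := hsum m
  have hsn := hsum n
  rw [hm] at hsm
  rw [hn] at hsn
  have haz : ∑ p ∈ s, a p • x p = z := by
    simp only [ha, mul_smul, sub_smul, ← Finset.smul_sum, Finset.sum_sub_distrib, hsm, hsn]
    rw [add_sub_add_right_eq_sub, ← sub_smul, smul_smul, inv_mul_cancel₀ hmn', one_smul]
  have hcoef : ∀ k : ℕ, S k = s → ∀ p ∈ s, c k p = c m p + ((k : ℝ) - m) * a p := by
    intro k hk
    refine F.coeff_unique hs ?_
    have hsk := hsum k
    rw [hk] at hsk
    simp only [add_smul, mul_smul, Finset.sum_add_distrib]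
    rw [← Finset.smul_sum, haz, hsm, hsk, sub_smul]
    abel
  have hanonneg : ∀ p ∈ s, 0 ≤ a p := by
    intro p hp
    by_contra! hneg
    obtain ⟨M, hM⟩ := exists_nat_gt ((m : ℝ) + c m p / (-a p))
    obtain ⟨k, hk : S k = s, hMk⟩ := hinf.exists_gt M
    have h1 := hcoef k hk p hp
    have h2 := hc k p (hk ▸ hp)
    have h3 : (M : ℝ) < k := by exact_mod_cast hMk
    have h4 : c m p / (-a p) < k - m := by linarith
    rw [div_lt_iff₀ (by linarith)] at h4
    linarith
  have hz0 : z ≠ 0 := fun h => F.zero_notMem he (h ▸ hz)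
  obtain ⟨t1, t2⟩ := F.exists_subset_of_nonneg hs hanonneg (haz.symm ▸ hz0)
  rw [haz] at t2
  refine ⟨s, hs, ?_, m, c m, fun p hp => hc m p (hm ▸ hp), hsm⟩
  rw [F.unique _ he _ t1 z hz t2]
  exact Finset.filter_subset _ _

omit F in
/-- `v`, `p`, `q` are the vertices of a positively oriented triangle. -/
def _root_.PolytopeRigidity.Tri (x : ι → E3) (𝒮 : Set (Finset ι)) (v p q : ι) : Prop :=
  {v, p, q} ∈ 𝒮 ∧ 0 < det3 (x v) (x p) (x q)

omit F [Fintype ι] in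
theorem _root_.PolytopeRigidity.Tri.rotate {v p q : ι} (h : Tri x 𝒮 v p q) : Tri x 𝒮 p q v := by
  refine ⟨?_, det3_rotate (x v) (x p) (x q) ▸ h.2⟩
  have : ({p, q, v} : Finset ι) = {v, p, q} := by ext; simp; tauto
  exact this ▸ h.1

omit F [Fintype ι] in
theorem _root_.PolytopeRigidity.Tri.ne {v p q : ι} (h : Tri x 𝒮 v p q) :
    v ≠ p ∧ v ≠ q ∧ p ≠ q := by
  refine ⟨?_, ?_, ?_⟩ <;> rintro rfl <;> simpa using h.2

/-- Push a point of the edge cone along the normal `d`. The face reached contains the edge, and is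
larger because `det3 (x v) (x p)` is positive there but vanishes on the edge cone. -/
theorem exists_left {v p : ι} (hvp : v ≠ p) (he : {v, p} ∈ 𝒮) : ∃ q, Tri x 𝒮 v p q := by
  set d := cross (x v) (x p) with hd
  have hpos : 0 < det3 (x v) (x p) d := by
    rw [← det3_rotate, ← inner_cross, ← hd]
    exact real_inner_self_pos.2 (F.cross_ne_zero hvp he)
  obtain ⟨s, hs, hes, n, c, hc, hsum⟩ :=
    F.exists_face_near he (pair_mem_openCone x hvp one_pos one_pos) d
  have hdet := congrArg (det3L (x v) (x p)) hsum
  simp only [map_add, map_smul, map_sum, det3L_apply, det3_self_outer, det3_self_right,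
    smul_eq_mul] at hdet
  have hv : v ∈ s := hes (by simp)
  have hp : p ∈ s := hes (by simp)
  by_cases hcard : s.card = 3
  · obtain ⟨q, hq⟩ : ∃ q, s = {v, p, q} := by
      have h1 : (s \ {v, p}).card = 1 := by
        rw [Finset.card_sdiff_of_subset hes, Finset.card_pair hvp, hcard]
      obtain ⟨q, hq⟩ := Finset.card_eq_one.1 h1
      refine ⟨q, ?_⟩
      rw [← Finset.sdiff_union_of_subset hes, hq]
      ext; simp; tauto
    have hvq : v ≠ q := by
      rintro rfl; rw [hq] at hcard
      have : ({v, p, v} : Finset ι) = {v, p} := by ext; simp; tauto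
      rw [this, Finset.card_pair hvp] at hcard; omega
    have hpq : p ≠ q := by
      rintro rfl; rw [hq] at hcard
      have : ({v, p, p} : Finset ι) = {v, p} := by ext; simp
      rw [this, Finset.card_pair hvp] at hcard; omega
    subst hq
    refine ⟨q, hs, ?_⟩
    rw [Finset.sum_insert (by simp [hvp, hvq]), Finset.sum_pair hpq] at hdet
    simp only [det3_self_outer, det3_self_right, mul_zero, zero_add] at hdet
    rw [← hdet] at hpos
    exact pos_of_mul_pos_right hpos (hc q (by simp)).le
  · exfalso
    have hle := F.card_le hs
    have hse : s = {v, p} := by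
      refine (Finset.eq_of_subset_of_card_le hes ?_).symm
      rw [Finset.card_pair hvp]; omega
    rw [hse, Finset.sum_pair hvp] at hdet
    simp only [det3_self_outer, det3_self_right, mul_zero, zero_add] at hdet
    linarith

/-- Two triangles on the same side of an edge overlap near it: for large `n`, `n • x v + n • x p + x
q'` lies in both open cones. -/
theorem left_unique {v p q q' : ι} (h : Tri x 𝒮 v p q) (h' : Tri x 𝒮 v p q') : q = q' := by
  obtain ⟨h1, h2, h3⟩ := h.ne
  obtain ⟨-, h2', h3'⟩ := h'.ne
  set D := det3 (x v) (x p) (x q) with hD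
  have hDpos : 0 < D := h.2
  have rel := det3_relation (x v) (x p) (x q) (x q')
  obtain ⟨n, hn⟩ := exists_gt (max 0 (max (-(det3 (x p) (x q) (x q') / D))
    (det3 (x v) (x q) (x q') / D)))
  simp only [max_lt_iff] at hn
  obtain ⟨hn0, hn1, hn2⟩ := hn
  have e : n • x v + n • x p + (1 : ℝ) • x q' =
      (n + det3 (x p) (x q) (x q') / D) • x v + (n - det3 (x v) (x q) (x q') / D) • x p
        + (det3 (x v) (x p) (x q') / D) • x q := by
    have : x q' = D⁻¹ • (det3 (x p) (x q) (x q') • x v - det3 (x v) (x q) (x q') • x p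
        - det3 (x v) (x q') (x p) • x q) := by
      rw [← rel, ← hD]
      have : D • x q' + det3 (x v) (x q) (x q') • x p + det3 (x v) (x q') (x p) • x q
          - det3 (x v) (x q) (x q') • x p - det3 (x v) (x q') (x p) • x q = D • x q' := by abel
      rw [this, smul_smul, inv_mul_cancel₀ hDpos.ne', one_smul]
    have hsw := det3_swap (x v) (x p) (x q')
    rw [one_smul]
    nth_rw 1 [this]
    rw [hsw]
    module
  have m1 := triple_mem_openCone x h1 h2' h3' hn0 hn0 one_pos
  rw [e] at m1
  have m2 := triple_mem_openCone x h1 h2 h3 (a := n + det3 (x p) (x q) (x q') / D)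
    (b := n - det3 (x v) (x q) (x q') / D) (c := det3 (x v) (x p) (x q') / D)
    (by linarith) (by linarith) (div_pos h'.2 hDpos)
  have := F.unique _ h'.1 _ h.1 _ m1 m2
  have hq : q ∈ ({v, p, q'} : Finset ι) := by rw [this]; simp
  simp only [Finset.mem_insert, Finset.mem_singleton] at hq
  rcases hq with rfl | rfl | rfl
  · exact absurd rfl h2
  · exact absurd rfl h3
  · rfl

-- Modulo `x v`, `d` is a positive combination of `x p` and `x q`; a large multiple of `x v` makes
-- the third coefficient positive.
omit F in
theorem _root_.PolytopeRigidity.mem_openCone_of_crossing {v p q : ι} (h : Tri x 𝒮 v p q) {d : E3}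
    (hp : 0 < det3 d (x v) (x p)) (hq : det3 d (x v) (x q) < 0) :
    ∃ M : ℝ, ∀ n > M, n • x v + d ∈ OpenCone x {v, p, q} := by
  set D := det3 (x v) (x p) (x q) with hD
  have hDpos : 0 < D := h.2
  refine ⟨-(det3 (x p) (x q) d / D), fun n hn => ?_⟩
  obtain ⟨h1, h2, h3⟩ := h.ne
  have m := triple_mem_openCone x h1 h2 h3 (a := n + det3 (x p) (x q) d / D)
    (b := -det3 d (x v) (x q) / D) (c := det3 d (x v) (x p) / D) (by linarith)
    (div_pos (neg_pos.2 hq) hDpos) (div_pos hp hDpos)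
  convert m using 1
  have rel := det3_relation (x v) (x p) (x q) d
  rw [← det3_rotate d, det3_swap (x v) (x p) d, ← det3_rotate d, ← hD] at rel
  have : d = D⁻¹ • (det3 (x p) (x q) d • x v - det3 d (x v) (x q) • x p
      + det3 d (x v) (x p) • x q) := by
    rw [← rel]
    have : D • d + det3 d (x v) (x q) • x p + -det3 d (x v) (x p) • x q
        - det3 d (x v) (x q) • x p + det3 d (x v) (x p) • x q = D • d := by module
    rw [this, smul_smul, inv_mul_cancel₀ hDpos.ne', one_smul]
  nth_rw 1 [this]
  module

theorem crossing_unique {v p q p' q' : ι} (h : Tri x 𝒮 v p q) (h' : Tri x 𝒮 v p' q') {d : E3}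
    (hp : 0 < det3 d (x v) (x p)) (hq : det3 d (x v) (x q) < 0)
    (hp' : 0 < det3 d (x v) (x p')) (hq' : det3 d (x v) (x q') < 0) : p = p' := by
  obtain ⟨M, hM⟩ := mem_openCone_of_crossing h hp hq
  obtain ⟨M', hM'⟩ := mem_openCone_of_crossing h' hp' hq'
  obtain ⟨n, hn⟩ := exists_gt (max M M')
  rw [max_lt_iff] at hn
  have := F.unique _ h.1 _ h'.1 _ (hM n hn.1) (hM' n hn.2)
  have hmem : p ∈ ({v, p', q'} : Finset ι) := by rw [← this]; simp
  simp only [Finset.mem_insert, Finset.mem_singleton] at hmem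
  rcases hmem with e | e | e
  · exact absurd e.symm h.ne.1
  · exact e
  · rw [e] at hp; linarith

theorem exists_adj (v : ι) : ∃ p, v ≠ p ∧ {v, p} ∈ 𝒮 := by
  obtain ⟨d, hd⟩ := exists_cross_ne_zero (F.pos_ne_zero v)
  obtain ⟨s, hs, hvs, n, c, hc, hsum⟩ :=
    F.exists_face_near (F.singleton_mem v) (single_mem_openCone x v one_pos) d
  by_cases hex : ∃ p ∈ s, v ≠ p
  · obtain ⟨p, hp, hvp⟩ := hex
    refine ⟨p, hvp, F.down s hs _ ?_ (by simp)⟩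
    intro i hi
    simp only [Finset.mem_insert, Finset.mem_singleton] at hi
    rcases hi with rfl | rfl
    · exact hvs (by simp)
    · exact hp
  · exfalso
    push Not at hex
    have hsv : s = {v} := by
      refine Finset.Subset.antisymm (fun p hp => by simp [hex p hp]) hvs
    rw [hsv, Finset.sum_singleton, one_smul] at hsum
    refine hd ?_
    have : d = (c v - n) • x v := by rw [sub_smul, hsum]; abel
    rw [this, cross_smul]
    have : cross (x v) (x v) = 0 := by
      apply ext_coord <;>
        simp only [cross_zero_coord, cross_one_coord, cross_two_coord, PiLp.zero_apply] <;> ring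
    rw [this, smul_zero]

theorem exists_tri {s : Finset ι} (hs : s ∈ 𝒮) : ∃ v p q, Tri x 𝒮 v p q ∧ s ⊆ {v, p, q} := by
  have h1 := F.card_le hs
  have h2 := (F.nonempty s hs).card_pos
  have hcases : s.card = 1 ∨ s.card = 2 ∨ s.card = 3 := by omega
  rcases hcases with h | h | h
  · obtain ⟨v, rfl⟩ := Finset.card_eq_one.1 h
    obtain ⟨p, hvp, he⟩ := F.exists_adj v
    obtain ⟨q, hq⟩ := F.exists_left hvp he
    exact ⟨v, p, q, hq, by simp⟩
  · obtain ⟨v, p, hvp, rfl⟩ := Finset.card_eq_two.1 h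
    obtain ⟨q, hq⟩ := F.exists_left hvp hs
    exact ⟨v, p, q, hq, by intro i; simp; tauto⟩
  · obtain ⟨v, p, q, hvp, hvq, hpq, rfl⟩ := Finset.card_eq_three.1 h
    rcases lt_or_gt_of_ne (F.det3_ne_zero hvp hvq hpq hs) with hn | hn
    · have : ({v, q, p} : Finset ι) = {v, p, q} := by ext; simp; tauto
      refine ⟨v, q, p, ⟨this ▸ hs, by rw [det3_swap]; linarith⟩, this ▸ subset_rfl⟩
    · exact ⟨v, p, q, ⟨hs, hn⟩, subset_rfl⟩

theorem isClosed_closedCone {s : Finset ι} (hs : s ∈ 𝒮) : IsClosed (ClosedCone x s) := by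
  set L : (s → ℝ) →ₗ[ℝ] E3 := Fintype.linearCombination ℝ fun p : s => x p with hL
  have h : LinearIndepOn ℝ x (s : Set ι) :=
    linearIndepOn_finset_iff.2 fun c hc => F.indep hs hc
  have hinj : Function.Injective L := linearIndependent_iff_injective_fintypeLinearCombination.1 h.linearIndependent
  have hemb := LinearMap.isClosedEmbedding_of_injective (f := L) (LinearMap.ker_eq_bot.2 hinj)
  have himg : ClosedCone x s = L '' {c | ∀ p, 0 ≤ c p} := by
    ext z
    constructor
    · rintro ⟨c, hc, rfl⟩
      refine ⟨fun p => c p, fun p => hc p p.2, ?_⟩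
      simp only [hL, Fintype.linearCombination_apply]
      exact Finset.sum_coe_sort s fun p => c p • x p
    · rintro ⟨c, hc, rfl⟩
      refine ⟨fun p => if h : p ∈ s then c ⟨p, h⟩ else 0, fun p hp => ?_, ?_⟩
      · simp only [hp, dif_pos]; exact hc _
      · simp only [hL, Fintype.linearCombination_apply]
        rw [← Finset.sum_coe_sort]
        exact Finset.sum_congr rfl fun p _ => by simp
  rw [himg]
  refine hemb.isClosedMap _ ?_
  simp only [Set.ofPred_forall]
  exact isClosed_iInter fun p => isClosed_le continuous_const (continuous_apply p)

/-- The triangles of a fan are connected through common edges. -/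
theorem eq_of_adjacent {α : Type*} (Φ : Finset ι → α)
    (hΦ : ∀ s ∈ 𝒮, ∀ t ∈ 𝒮, s.card = 3 → t.card = 3 → 2 ≤ (s ∩ t).card → Φ s = Φ t)
    {a b c : ι} (hs : Tri x 𝒮 a b c) {t : Finset ι} (ht : t ∈ 𝒮) (htc : t.card = 3) :
    Φ {a, b, c} = Φ t := by
  classical
  set s : Finset ι := {a, b, c} with hsdef
  have hsS : s ∈ 𝒮 := hs.1
  have hsc : s.card = 3 := Finset.card_eq_three.2 ⟨a, b, c, hs.ne.1, hs.ne.2.1, hs.ne.2.2, rfl⟩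
  obtain ⟨z₁, hz₁⟩ : (OpenCone x t).Nonempty := ⟨_, fun _ => 1, fun _ _ => one_pos, rfl⟩
  have hz₁0 : z₁ ≠ 0 := fun h => F.zero_notMem ht (h ▸ hz₁)
  -- Start the segment to `z₁` off all planes containing `z₁` and some `x p`: it can then meet a
  -- vertex ray only at `z₁`, which is interior to the cone of `t`. So it avoids the vertex rays
  -- altogether.
  have hfun : ∀ p, ∃ h : E3 →ₗ[ℝ] ℝ, h ≠ 0 ∧ h z₁ = 0 ∧ h (x p) = 0 := by
    intro p
    by_cases hcr : cross z₁ (x p) = 0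
    · obtain ⟨d, hd⟩ := exists_cross_ne_zero hz₁0
      refine ⟨det3L z₁ d, fun h0 => hd ?_, by simp, ?_⟩
      · rw [← inner_self_eq_zero (𝕜 := ℝ), inner_cross, det3_rotate]
        exact congrArg (fun h : E3 →ₗ[ℝ] ℝ => h (cross z₁ d)) h0
      · rw [det3L_apply, det3_swap, ← det3_rotate, ← inner_cross, hcr, inner_zero_right, neg_zero]
    · refine ⟨det3L z₁ (x p), fun h0 => hcr ?_, by simp, by simp⟩
      rw [← inner_self_eq_zero (𝕜 := ℝ), inner_cross, det3_rotate]
      exact congrArg (fun h : E3 →ₗ[ℝ] ℝ => h (cross z₁ (x p))) h0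
  choose h hne h1 hp using hfun
  obtain ⟨r, hr, hgen⟩ := exists_generic hs.2.ne' h hne
  set z₀ : E3 := x a + r • x b + r ^ 2 • x c with hz₀
  have hz₀mem : z₀ ∈ OpenCone x s := by
    have := triple_mem_openCone x hs.ne.1 hs.ne.2.1 hs.ne.2.2 one_pos hr (pow_pos hr 2)
    rwa [one_smul] at this
  set γ : ℝ → E3 := fun τ => (1 - τ) • z₀ + τ • z₁ with hγ
  have γcont : Continuous γ := by fun_prop
  have γ1 : γ 1 = z₁ := by simp [hγ]
  have γ0 : γ 0 = z₀ := by simp [hγ]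
  have hval : ∀ p τ, h p (γ τ) = (1 - τ) * h p z₀ := fun p τ => by simp [hγ, h1]
  have γne : ∀ τ ∈ Set.Icc (0 : ℝ) 1, γ τ ≠ 0 := by
    intro τ _ h0
    have := hval a τ
    rw [h0, map_zero] at this
    have hτ : τ = 1 := by
      rcases mul_eq_zero.1 this.symm with h | h
      · linarith
      · exact absurd h (hgen a)
    rw [hτ, γ1] at h0
    exact hz₁0 h0
  have γray : ∀ τ ∈ Set.Icc (0 : ℝ) 1, ∀ p, γ τ ∉ OpenCone x {p} := by
    rintro τ - p hmem
    have hτ : τ = 1 := by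
      obtain ⟨k, -, hk⟩ := hmem
      have := hval p τ
      rw [← hk, Finset.sum_singleton, map_smul, hp, smul_zero] at this
      rcases mul_eq_zero.1 this.symm with h | h
      · linarith
      · exact absurd h (hgen p)
    rw [hτ, γ1] at hmem
    have := F.unique _ ht _ (F.singleton_mem p) _ hz₁ hmem
    rw [this, Finset.card_singleton] at htc
    omega
  have open_sub : ∀ {u u' : Finset ι} {z}, u ⊆ u' → z ∈ OpenCone x u → z ∈ ClosedCone x u' := by
    rintro u u' z hu ⟨k, hk, rfl⟩
    refine ⟨fun p => if p ∈ u then k p else 0, fun p _ => ?_, ?_⟩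
    · dsimp only; split_ifs with hpu
      exacts [(hk p hpu).le, le_rfl]
    · simp only [ite_smul, zero_smul]
      rw [Finset.sum_ite_mem, Finset.inter_eq_right.2 hu]
  set C : (Finset ι → Prop) → Set ℝ := fun Q =>
    ⋃ u : {u : Finset ι // u ∈ 𝒮 ∧ u.card = 3 ∧ Q u}, γ ⁻¹' ClosedCone x u.1 with hC
  have Cclosed : ∀ Q, IsClosed (C Q) := fun Q =>
    isClosed_iUnion_of_finite fun u => (F.isClosed_closedCone u.2.1).preimage γcont
  by_contra hne'
  have hpre := isPreconnected_closed_iff.1 (isPreconnected_Icc (a := (0 : ℝ)) (b := 1))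
    (C fun u => Φ u = Φ s) (C fun u => Φ u ≠ Φ s) (Cclosed _) (Cclosed _) ?_ ?_ ?_
  -- A point common to both closed sets lies in the open cone of a face shared by two triangles.
  -- That face has at least two vertices, so `Φ` agrees on the triangles.
  · obtain ⟨τ, hτ, hτ1, hτ2⟩ := hpre
    obtain ⟨⟨u, hu, huc, huΦ⟩, k, hk, hks⟩ := Set.mem_iUnion.1 hτ1
    obtain ⟨⟨u', hu', huc', huΦ'⟩, k', hk', hks'⟩ := Set.mem_iUnion.1 hτ2
    dsimp only at hks hks'
    obtain ⟨m1, m2⟩ := F.exists_subset_of_nonneg hu hk (hks ▸ γne τ hτ)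
    obtain ⟨m1', m2'⟩ := F.exists_subset_of_nonneg hu' hk' (hks' ▸ γne τ hτ)
    rw [hks] at m2
    rw [hks'] at m2'
    have e := F.unique _ m1 _ m1' _ m2 m2'
    refine huΦ' ((hΦ u' hu' u hu huc' huc ?_).trans huΦ)
    have hsub : {p ∈ u | 0 < k p} ⊆ u' ∩ u :=
      Finset.subset_inter (e ▸ Finset.filter_subset _ _) (Finset.filter_subset _ _)
    refine le_trans ?_ (Finset.card_le_card hsub)
    have hpos := (F.nonempty _ m1).card_pos
    by_contra! hlt
    obtain ⟨p, hp⟩ := Finset.card_eq_one.1 (show ({p ∈ u | 0 < k p}).card = 1 by omega)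
    rw [hp] at m2
    exact γray τ hτ p m2
  · intro τ hτ
    obtain ⟨u, hu, hmem⟩ := F.cover _ (γne τ hτ)
    obtain ⟨v, p, q, htri, hsub⟩ := F.exists_tri hu
    have hcard := Finset.card_eq_three.2 ⟨v, p, q, htri.ne.1, htri.ne.2.1, htri.ne.2.2, rfl⟩
    by_cases hΦu : Φ {v, p, q} = Φ s
    · exact Or.inl (Set.mem_iUnion.2 ⟨⟨_, htri.1, hcard, hΦu⟩, open_sub hsub hmem⟩)
    · exact Or.inr (Set.mem_iUnion.2 ⟨⟨_, htri.1, hcard, hΦu⟩, open_sub hsub hmem⟩)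
  · exact ⟨0, by simp, Set.mem_iUnion.2 ⟨⟨s, hsS, hsc, rfl⟩,
      open_sub subset_rfl (γ0.symm ▸ hz₀mem)⟩⟩
  · exact ⟨1, by simp, Set.mem_iUnion.2 ⟨⟨t, ht, htc, fun h => hne' h.symm⟩,
      open_sub subset_rfl (γ1.symm ▸ hz₁)⟩⟩

end IsConvexFan

/-! ### Infinitesimal motions of a single triangle. -/

theorem eq_smul_of_cross_eq_zero {a b : E3} (hb : b ≠ 0) (h : cross a b = 0) :
    ∃ l : ℝ, a = l • b := by
  have hbb : (inner ℝ b b : ℝ) ≠ 0 := fun h => hb (inner_self_eq_zero.1 h)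
  have h' : cross b a = 0 := by
    have : cross b a = (-1 : ℝ) • cross a b := by
      apply ext_coord <;>
        simp only [PiLp.smul_apply, smul_eq_mul, cross_zero_coord, cross_one_coord,
          cross_two_coord] <;> ring
    rw [this, h, smul_zero]
  refine ⟨(inner ℝ b b)⁻¹ * inner ℝ b a, ?_⟩
  have h1 := cross_eq_zero_relation h'
  rw [mul_smul, ← sub_eq_zero]
  have h2 : (inner ℝ b b : ℝ)⁻¹ • ((-inner ℝ b a : ℝ) • b + (inner ℝ b b : ℝ) • a) = 0 := by
    rw [h1, smul_zero]
  rw [smul_add, smul_smul _ _ a, inv_mul_cancel₀ hbb, one_smul] at h2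
  rw [← h2]
  module

theorem eq_of_inner_eq {n a b z z' : E3} (hn : n = cross a b) (hne : n ≠ 0)
    (ha : inner ℝ a z = (inner ℝ a z' : ℝ)) (hb : inner ℝ b z = (inner ℝ b z' : ℝ))
    (hc : inner ℝ n z = (inner ℝ n z' : ℝ)) : z = z' := by
  rw [← sub_eq_zero]
  rw [← sub_eq_zero, ← inner_sub_right] at ha hb hc
  set u := z - z'
  have h1 : cross n u = 0 := by
    have : cross n u = (inner ℝ a u : ℝ) • b - (inner ℝ b u : ℝ) • a := by
      rw [hn]
      apply ext_coord <;>
        simp only [PiLp.smul_apply, PiLp.sub_apply, smul_eq_mul, cross_zero_coord, cross_one_coord,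
          cross_two_coord, inner_coord] <;> ring
    rw [this, ha, hb, zero_smul, zero_smul, sub_zero]
  have h2 := cross_eq_zero_relation h1
  rw [hc, neg_zero, zero_smul, zero_add] at h2
  rcases smul_eq_zero.1 h2 with h | h
  · exact absurd (inner_self_eq_zero.1 h) hne
  · exact h

/-- An infinitesimal motion of two linearly independent edge vectors of a triangle that preserves
the inner products to first order is an infinitesimal rotation. -/
theorem exists_angular_velocity {a b α β : E3} (hab : cross a b ≠ 0) (hα : inner ℝ a α = (0 : ℝ))
    (hβ : inner ℝ b β = (0 : ℝ)) (hαβ : inner ℝ a β + inner ℝ b α = (0 : ℝ)) :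
    ∃ ω, cross ω a = α ∧ cross ω b = β := by
  set n := cross a b with hn
  have hnn : (inner ℝ n n : ℝ) ≠ 0 := fun h => hab (inner_self_eq_zero.1 h)
  -- The coefficients in the basis `n`, `a`, `b` are read off by pairing `ω × a` with `b` and `n`,
  -- and `ω × b` with `n`.
  set ω : E3 := (inner ℝ n n : ℝ)⁻¹ •
    ((inner ℝ b α : ℝ) • n + (inner ℝ n β : ℝ) • a - (inner ℝ n α : ℝ) • b) with hω
  have key : ∀ c d : E3, inner ℝ c (cross ω d) = (inner ℝ n n : ℝ)⁻¹ *
      (inner ℝ b α * det3 c n d + inner ℝ n β * det3 c a d - inner ℝ n α * det3 c b d) := by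
    intro c d
    rw [inner_cross, hω]
    simp only [det3, PiLp.smul_apply, PiLp.sub_apply, PiLp.add_apply, smul_eq_mul]
    ring
  have n1 : det3 n a b = inner ℝ n n := by rw [← inner_cross]
  have n2 : det3 n b a = -inner ℝ n n := by rw [det3_swap, n1]
  have n3 : det3 b n a = inner ℝ n n := by rw [det3_rotate, n1]
  have n4 : det3 a n b = -inner ℝ n n := by rw [det3_rotate, n2]
  refine ⟨ω, eq_of_inner_eq hn hab ?_ ?_ ?_, eq_of_inner_eq hn hab ?_ ?_ ?_⟩ <;>
    rw [key] <;> simp only [n1, n2, n3, n4, det3_self_left, det3_self_right, det3_self_outer,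
      hα, hβ, mul_zero, add_zero, zero_add, sub_zero, zero_sub] <;>
    field_simp <;> linarith

/-! ### Rigidity of convex fans. -/

namespace IsConvexFan

variable {x : ι → E3} {𝒮 : Set (Finset ι)} (F : IsConvexFan x 𝒮) {w : ι → E3}
  (hw : ∀ p q, p ≠ q → {p, q} ∈ 𝒮 → inner ℝ (x p - x q) (w p - w q) = (0 : ℝ))

include F in
theorem cross_sub_ne_zero {v p q : ι} (h : Tri x 𝒮 v p q) :
    cross (x p - x v) (x q - x v) ≠ 0 := by
  intro h0
  have : inner ℝ (x v) (cross (x p - x v) (x q - x v)) = det3 (x v) (x p) (x q) := by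
    rw [inner_cross]; simp only [det3, PiLp.sub_apply]; ring
  rw [h0, inner_zero_right] at this
  exact h.2.ne this

include F hw in
theorem exists_motion {s : Finset ι} (hs : s ∈ 𝒮) :
    ∃ m : E3 × E3, ∀ p ∈ s, w p = cross m.1 (x p) + m.2 := by
  obtain ⟨v, p, q, htri, hsub⟩ := F.exists_tri hs
  obtain ⟨h1, h2, h3⟩ := htri.ne
  have edge : ∀ {i j}, i ∈ ({v, p, q} : Finset ι) → j ∈ ({v, p, q} : Finset ι) →
      ({i, j} : Finset ι) ∈ 𝒮 := fun hi hj =>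
    F.down _ htri.1 _ (by intro k hk; simp only [Finset.mem_insert, Finset.mem_singleton] at hk
                          rcases hk with rfl | rfl <;> assumption) (by simp)
  have e1 := hw p v h1.symm (edge (by simp) (by simp))
  have e2 := hw q v h2.symm (edge (by simp) (by simp))
  have e3 := hw p q h3 (edge (by simp) (by simp))
  obtain ⟨ω, ha, hb⟩ := exists_angular_velocity (F.cross_sub_ne_zero htri) e1 e2 (by
    simp only [inner_coord, PiLp.sub_apply] at e1 e2 e3 ⊢; linarith)
  refine ⟨(ω, w v - cross ω (x v)), fun i hi => ?_⟩
  rw [cross_sub] at ha hb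
  have hi' := hsub hi
  simp only [Finset.mem_insert, Finset.mem_singleton] at hi'
  dsimp only
  rcases hi' with rfl | rfl | rfl
  · abel
  · rw [eq_comm, ← sub_eq_zero, ← sub_eq_zero.2 ha]; abel
  · rw [eq_comm, ← sub_eq_zero, ← sub_eq_zero.2 hb]; abel

include F in
theorem eq_left_or_right {v p : ι} {L R : ι} (hL : Tri x 𝒮 v p L) (hR : Tri x 𝒮 p v R)
    {s : Finset ι} (hs : s ∈ 𝒮) (hcard : s.card = 3) (hv : v ∈ s) (hp : p ∈ s) :
    s = {v, p, L} ∨ s = {p, v, R} := by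
  have hvp := hL.ne.1
  have hsub : ({v, p} : Finset ι) ⊆ s := by intro i; simp; rintro (rfl | rfl) <;> assumption
  obtain ⟨q, hq⟩ : ∃ q, s \ {v, p} = {q} := by
    rw [← Finset.card_eq_one, Finset.card_sdiff_of_subset hsub, Finset.card_pair hvp, hcard]
  have hqs : q ∈ s \ {v, p} := by rw [hq]; simp
  simp only [Finset.mem_sdiff, Finset.mem_insert, Finset.mem_singleton, not_or] at hqs
  have hs1 : s = {v, p, q} := by
    rw [← Finset.sdiff_union_of_subset hsub, hq]; ext; simp; tauto
  have hs2 : s = {p, v, q} := by rw [hs1]; ext; simp; tauto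
  rcases lt_or_gt_of_ne (F.det3_ne_zero hvp (Ne.symm hqs.2.1) (Ne.symm hqs.2.2) (hs1 ▸ hs))
    with hn | hn
  · right
    have : Tri x 𝒮 p v q := ⟨hs2 ▸ hs, by rw [det3_rotate, det3_swap]; linarith⟩
    rw [F.left_unique hR this, hs2]
  · left
    rw [F.left_unique hL ⟨hs1 ▸ hs, hn⟩, hs1]

theorem _root_.PolytopeRigidity.Tri.adj (F : IsConvexFan x 𝒮) {v p q : ι}
    (h : Tri x 𝒮 v p q) : v ≠ p ∧ ({v, p} : Finset ι) ∈ 𝒮 :=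
  ⟨h.ne.1, F.down _ h.1 _ (by intro i; simp; tauto) (by simp)⟩

include F in
/-- The cyclic order of the neighbours of a vertex. -/
theorem exists_successor (v : ι) : ∃ σ : Equiv.Perm {p : ι // v ≠ p ∧ {v, p} ∈ 𝒮},
    ∀ p : {p : ι // v ≠ p ∧ {v, p} ∈ 𝒮}, Tri x 𝒮 v p (σ p) := by
  choose L hL using fun p : {p : ι // v ≠ p ∧ {v, p} ∈ 𝒮} => F.exists_left p.2.1 p.2.2
  set s : {p : ι // v ≠ p ∧ {v, p} ∈ 𝒮} → {p : ι // v ≠ p ∧ {v, p} ∈ 𝒮} :=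
    fun p => ⟨L p, by
      have h := (hL p).rotate.rotate.adj F
      exact ⟨h.1.symm, by rw [Finset.pair_comm]; exact h.2⟩⟩ with hs
  have hinj : Function.Injective s := by
    intro p q hpq
    have e : L p = L q := congrArg Subtype.val hpq
    have h1 := (hL p).rotate.rotate
    have h2 := (hL q).rotate.rotate
    rw [← e] at h2
    exact Subtype.ext (F.left_unique h1 h2)
  exact ⟨Equiv.ofBijective s (Finite.injective_iff_bijective.1 hinj), hL⟩

include F hw in
/-- Infinitesimal rigidity for convex fans. -/
theorem exists_infinitesimal_rigid_motion :
    ∃ ω τ : E3, ∀ p, w p = cross ω (x p) + τ := by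
  classical
  have hm : ∀ s : Finset ι, ∃ m : E3 × E3, s ∈ 𝒮 → s.card = 3 →
      ∀ p ∈ s, w p = cross m.1 (x p) + m.2 := by
    intro s
    by_cases h : s ∈ 𝒮 ∧ s.card = 3
    · obtain ⟨m, hm⟩ := F.exists_motion hw h.1
      exact ⟨m, fun _ _ => hm⟩
    · exact ⟨0, fun h1 h2 => absurd ⟨h1, h2⟩ h⟩
  choose m hm using hm
  have htri : ∀ {v p q}, Tri x 𝒮 v p q → ∀ i ∈ ({v, p, q} : Finset ι),
      w i = cross (m {v, p, q}).1 (x i) + (m {v, p, q}).2 := fun h =>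
    hm _ h.1 (Finset.card_eq_three.2 ⟨_, _, _, h.ne.1, h.ne.2.1, h.ne.2.2, rfl⟩)
  have hdiff : ∀ {v p q}, Tri x 𝒮 v p q → ∀ i ∈ ({v, p, q} : Finset ι),
      ∀ j ∈ ({v, p, q} : Finset ι),
      w i - w j = cross (m {v, p, q}).1 (x i - x j) := by
    intro v p q h i hi j hj
    rw [htri h i hi, htri h j hj, cross_sub]; abel
  -- The two motions agree at `x v` and `x p`, so the difference of angular velocities is parallel
  -- to the edge.
  have hl : ∀ v p, ∃ l : ℝ, ∀ q r, Tri x 𝒮 v p q → Tri x 𝒮 p v r →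
      (m {v, p, q}).1 - (m {p, v, r}).1 = l • (x p - x v) := by
    intro v p
    by_cases h : ∃ q r, Tri x 𝒮 v p q ∧ Tri x 𝒮 p v r
    · obtain ⟨q, r, hq, hr⟩ := h
      have hne : x p - x v ≠ 0 := by
        intro h0
        have := hq.2
        rw [sub_eq_zero.1 h0, det3_self_left] at this
        exact lt_irrefl _ this
      obtain ⟨l, hl⟩ := eq_smul_of_cross_eq_zero (a := (m {v, p, q}).1 - (m {p, v, r}).1) hne (by
        rw [sub_cross, ← hdiff hq p (by simp) v (by simp), ← hdiff hr p (by simp) v (by simp),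
          sub_self])
      refine ⟨l, fun q' r' hq' hr' => ?_⟩
      rw [F.left_unique hq' hq, F.left_unique hr' hr, hl]
    · exact ⟨0, fun q r hq hr => absurd ⟨q, r, hq, hr⟩ h⟩
  choose lam hlam using hl
  have lam_symm : ∀ v p, v ≠ p ∧ {v, p} ∈ 𝒮 → lam v p = lam p v := by
    rintro v p ⟨hvp, he⟩
    obtain ⟨q, hq⟩ := F.exists_left hvp he
    obtain ⟨r, hr⟩ := F.exists_left hvp.symm (by rwa [Finset.pair_comm])
    have h1 := hlam v p q r hq hr
    have h2 := hlam p v r q hr hq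
    have hne : x p - x v ≠ 0 := by
      intro h0
      have := hq.2
      rw [sub_eq_zero.1 h0, det3_self_left] at this
      exact lt_irrefl _ this
    have h3 : (lam v p - lam p v) • (x p - x v) = 0 := by
      have : (lam v p - lam p v) • (x p - x v) = lam v p • (x p - x v)
        + lam p v • (x v - x p) := by module
      rw [this, ← h1, ← h2]; abel
    exact sub_eq_zero.1 ((smul_eq_zero.1 h3).resolve_right hne)
  have vertex : ∀ v, ∑ p : {p : ι // v ≠ p ∧ {v, p} ∈ 𝒮},
        lam v p * inner ℝ (x v) (w p - w v) ≤ 0 ∧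
      (∑ p : {p : ι // v ≠ p ∧ {v, p} ∈ 𝒮}, lam v p * inner ℝ (x v) (w p - w v) = 0 →
        ∀ p : {p : ι // v ≠ p ∧ {v, p} ∈ 𝒮}, lam v p = 0) := by
    intro v
    obtain ⟨σ, hσ⟩ := F.exists_successor v
    obtain ⟨g, hgv, hg⟩ := F.pointed v
    choose A hA1 hA using fun p : {p : ι // v ≠ p ∧ {v, p} ∈ 𝒮} => F.support _ (hσ p).1
    -- The direction `d` is chosen so that no neighbour of `v` lies in the plane of `x v` and `d`.
    obtain ⟨a, b, c, habc, -⟩ := F.exists_tri (F.singleton_mem v)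
    obtain ⟨t, -, hd⟩ := exists_generic habc.2.ne'
      (fun p : {p : ι // v ≠ p ∧ {v, p} ∈ 𝒮} => det3L (x v) (x p)) (fun p h0 =>
        F.cross_ne_zero p.2.1 p.2.2 (by
          rw [← inner_self_eq_zero (𝕜 := ℝ), inner_cross, det3_rotate]
          exact congrArg (fun h : E3 →ₗ[ℝ] ℝ => h (cross (x v) (x p))) h0))
    set d := x a + t • x b + t ^ 2 • x c
    have hσr : ∀ p, Tri x 𝒮 (σ p) v p := fun p => (hσ p).rotate.rotate
    have hset : ∀ p, ({(σ p).1, v, p.1} : Finset ι) = {v, p.1, (σ p).1} := by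
      intro p; ext; simp; tauto
    have jump : ∀ p, (m {v, (σ p).1, (σ (σ p)).1}).1 - (m {v, p.1, (σ p).1}).1 =
        lam v (σ p) • (x (σ p) - x v) := by
      intro p
      rw [← hlam v (σ p) _ _ (hσ (σ p)) (hσr p), hset]
    have main := vertex_form_nonpos σ (x v) (fun p => x p.1) d
      (fun p => by rw [det3_rotate]; exact hd p) (fun p => (hσ p).2)
      (fun p => det3L (x v) (m {v, p.1, (σ p).1}).1) (fun p => lam v p)
      (fun p => by simp) (fun p z => by
        have h1 : det3 (x v) (x (σ p)) z = det3 (x v) (x (σ p) - x v) z := by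
          simp only [det3, PiLp.sub_apply]; ring
        have h2 : lam v (σ p) * det3 (x v) (x (σ p) - x v) z =
            det3 (x v) (lam v (σ p) • (x (σ p) - x v)) z := by
          simp only [det3, PiLp.smul_apply, smul_eq_mul]; ring
        rw [h1, h2, ← jump p]
        simp only [det3L_apply, det3, PiLp.sub_apply]; ring)
      (by
        -- Equilibrium: the jumps of angular velocity cancel around `v`.
        rw [← Equiv.sum_comp σ fun p => lam v p.1 • (x p.1 - x v)]
        simp only [← jump, Finset.sum_sub_distrib]
        rw [sub_eq_zero]
        exact Equiv.sum_comp σ fun p => (m {v, p.1, (σ p).1}).1)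
      A (fun p => hA1 p v (by simp)) (fun p => hA1 p p (by simp))
      (fun p => hA1 p (σ p) (by simp)) (fun p q => hA p q) g hgv (fun p => hg p p.2.1.symm)
      (fun p q a b c d => Subtype.ext (F.crossing_unique (hσ p) (hσ q) a b c d))
      -- A downward crossing for `d` is an upward crossing for `-d`.
      (fun p q a b c e => Subtype.ext (F.crossing_unique (d := -d) (hσ p) (hσ q)
        (by simp only [det3, PiLp.neg_apply] at a ⊢; linarith)
        (by simp only [det3, PiLp.neg_apply] at b ⊢; linarith)
        (by simp only [det3, PiLp.neg_apply] at c ⊢; linarith)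
        (by simp only [det3, PiLp.neg_apply] at e ⊢; linarith)))
    have hval : ∀ p : {p : ι // v ≠ p ∧ {v, p} ∈ 𝒮},
        det3L (x v) (m {v, p.1, (σ p).1}).1 (x p) = inner ℝ (x v) (w p - w v) := by
      intro p
      rw [hdiff (hσ p) p.1 (by simp) v (by simp), inner_cross]
      simp only [det3L_apply, det3, PiLp.sub_apply]; ring
    simpa only [hval] using main
  have total : ∑ v, ∑ p : {p : ι // v ≠ p ∧ {v, p} ∈ 𝒮},
      lam v p * inner ℝ (x v) (w p - w v) = 0 := by
    set c : ι → ι → ℝ := fun v p => if v ≠ p ∧ {v, p} ∈ 𝒮 then lam v p else 0 with hc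
    have hsum : ∀ v, ∑ p : {p : ι // v ≠ p ∧ {v, p} ∈ 𝒮}, lam v p * inner ℝ (x v) (w p - w v) =
        ∑ p, c v p * inner ℝ (x v) (w p - w v) := by
      intro v
      simp only [hc, ite_mul, zero_mul]
      rw [← Finset.sum_filter]
      exact (Finset.sum_subtype (p := fun p => v ≠ p ∧ {v, p} ∈ 𝒮) _ (by simp)
        fun p => lam v p * inner ℝ (x v) (w p - w v)).symm
    have c_symm : ∀ v p, c v p = c p v := by
      intro v p
      simp only [hc, ne_comm (a := v), Finset.pair_comm v p]
      split_ifs with h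
      · exact lam_symm v p ⟨h.1.symm, by rw [Finset.pair_comm]; exact h.2⟩
      · rfl
    have c_flex : ∀ v p, c v p * inner ℝ (x v - x p) (w v - w p) = 0 := by
      intro v p
      simp only [hc]
      split_ifs with h
      · rw [hw v p h.1 h.2, mul_zero]
      · rw [zero_mul]
    simp only [hsum]
    set T := ∑ v, ∑ p, c v p * inner ℝ (x v) (w p - w v) with hT
    have hswap : T = ∑ v, ∑ p, c v p * inner ℝ (x p) (w v - w p) := by
      rw [hT, Finset.sum_comm]
      exact Finset.sum_congr rfl fun v _ => Finset.sum_congr rfl fun p _ => by rw [c_symm]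
    have h2 : T + T = 0 := by
      nth_rw 2 [hswap]
      rw [hT, ← Finset.sum_add_distrib]
      refine Finset.sum_eq_zero fun v _ => ?_
      rw [← Finset.sum_add_distrib]
      refine Finset.sum_eq_zero fun p _ => ?_
      have := c_flex v p
      simp only [inner_coord, PiLp.sub_apply] at this ⊢
      linarith
    linarith
  have lam_zero : ∀ v p, v ≠ p ∧ {v, p} ∈ 𝒮 → lam v p = 0 := by
    intro v p h
    have h0 := (Finset.sum_eq_zero_iff_of_nonpos fun v _ => (vertex v).1).1 total v
      (Finset.mem_univ v)
    exact (vertex v).2 h0 ⟨p, h⟩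
  have adj_eq : ∀ v p q r, Tri x 𝒮 v p q → Tri x 𝒮 p v r → m {v, p, q} = m {p, v, r} := by
    intro v p q r hq hr
    have h1 := hlam v p q r hq hr
    rw [lam_zero v p (hq.adj F), zero_smul, sub_eq_zero] at h1
    refine Prod.ext h1 ?_
    have h2 := htri hq v (by simp)
    rw [htri hr v (by simp), h1] at h2
    exact (add_left_cancel h2).symm
  have hΦ : ∀ s ∈ 𝒮, ∀ t ∈ 𝒮, s.card = 3 → t.card = 3 → 2 ≤ (s ∩ t).card → m s = m t := by
    intro s hs t ht hsc htc hst
    obtain ⟨v, hv, p, hp, hvp⟩ := Finset.one_lt_card.1 hst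
    rw [Finset.mem_inter] at hv hp
    have he : ({v, p} : Finset ι) ∈ 𝒮 := F.down s hs _ (by
      intro i; simp; rintro (rfl | rfl); exacts [hv.1, hp.1]) (by simp)
    obtain ⟨L, hL⟩ := F.exists_left hvp he
    obtain ⟨R, hR⟩ := F.exists_left hvp.symm (by rwa [Finset.pair_comm])
    have e := adj_eq v p L R hL hR
    rcases F.eq_left_or_right hL hR hs hsc hv.1 hp.1 with h1 | h1 <;>
    rcases F.eq_left_or_right hL hR ht htc hv.2 hp.2 with h2 | h2 <;>
    simp only [h1, h2, e]
  rcases isEmpty_or_nonempty ι with hι | ⟨⟨p₀⟩⟩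
  · exact ⟨0, 0, fun p => isEmptyElim p⟩
  obtain ⟨a, b, c, habc, -⟩ := F.exists_tri (F.singleton_mem p₀)
  refine ⟨(m {a, b, c}).1, (m {a, b, c}).2, fun v => ?_⟩
  obtain ⟨i, j, k, hijk, hsub⟩ := F.exists_tri (F.singleton_mem v)
  have hcard := Finset.card_eq_three.2 ⟨i, j, k, hijk.ne.1, hijk.ne.2.1, hijk.ne.2.2, rfl⟩
  rw [F.eq_of_adjacent m hΦ habc hijk.1 hcard]
  exact htri hijk v (hsub (by simp))

end IsConvexFan

end Fan

open scoped Topology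

/-! ### Radial projection of a convex body to its boundary. -/

section Radial

variable {P : Set E3} {o : E3}

theorem mem_frontier_iff_gauge (hconv : Convex ℝ P) (ho : o ∈ interior P) (z : E3) :
    o + z ∈ frontier P ↔ gauge ((fun y => o + y) ⁻¹' P) z = 1 := by
  have h0 : (fun y => o + y) ⁻¹' P ∈ 𝓝 (0 : E3) :=
    (continuous_const_add o).continuousAt.preimage_mem_nhds
      (by simpa using mem_interior_iff_mem_nhds.1 ho)
  rw [gauge_eq_one_iff_mem_frontier (hconv.translate_preimage_right o) h0]
  have := (Homeomorph.addLeft o).preimage_frontier P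
  rw [Homeomorph.coe_addLeft] at this
  rw [← this]
  rfl

theorem exists_smul_mem_frontier (hconv : Convex ℝ P) (hbdd : Bornology.IsBounded P)
    (ho : o ∈ interior P) {z : E3} (hz : z ≠ 0) : ∃ r : ℝ, 0 < r ∧ o + r • z ∈ frontier P := by
  set Q := (fun y => o + y) ⁻¹' P with hQ
  have h0 : Q ∈ 𝓝 (0 : E3) :=
    (continuous_const_add o).continuousAt.preimage_mem_nhds
      (by simpa using mem_interior_iff_mem_nhds.1 ho)
  have hb : Bornology.IsBounded Q := by
    have : Q = (fun y => -o + y) '' P := by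
      ext y
      constructor
      · intro h; exact ⟨o + y, h, by simp⟩
      · rintro ⟨u, hu, rfl⟩; simpa [hQ] using hu
    rw [this]
    exact ((isometry_add_left (-o)).lipschitz).isBounded_image hbdd
  have hpos : 0 < gauge Q z :=
    (gauge_pos (absorbent_nhds_zero h0) (NormedSpace.isVonNBounded_of_isBounded ℝ hb)).2 hz
  refine ⟨(gauge Q z)⁻¹, inv_pos.2 hpos, ?_⟩
  rw [mem_frontier_iff_gauge hconv ho, gauge_smul_of_nonneg (inv_nonneg.2 hpos.le), smul_eq_mul,
    inv_mul_cancel₀ hpos.ne']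

theorem eq_one_of_smul_mem_frontier (hconv : Convex ℝ P) (ho : o ∈ interior P) {z : E3} {r : ℝ}
    (hr : 0 < r) (h1 : o + z ∈ frontier P) (h2 : o + r • z ∈ frontier P) : r = 1 := by
  rw [mem_frontier_iff_gauge hconv ho] at h1 h2
  rw [gauge_smul_of_nonneg hr.le, h1, smul_eq_mul, mul_one] at h2
  exact h2

/-- The inequality at `o` is strict because a nonzero functional still increases along a short step
from `o` inside `P`. -/
theorem exists_supporting_functional (hconv : Convex ℝ P) (ho : o ∈ interior P) {b : E3}
    (hb : b ∉ interior P) : ∃ f : E3 →ₗ[ℝ] ℝ, f o < f b ∧ ∀ a ∈ P, f a ≤ f b := by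
  obtain ⟨f, hf, hfb⟩ := geometric_hahn_banach_of_nonempty_interior_point hconv hb ⟨o, ho⟩
  obtain ⟨u, hu⟩ : ∃ u, 0 < f u := by
    by_contra! hcon
    refine hf (ContinuousLinearMap.ext fun u => le_antisymm (hcon u) ?_)
    have := hcon (-u)
    rw [map_neg] at this
    simpa using this
  have hnear : ∀ᶠ t : ℝ in 𝓝 0, o + t • u ∈ P := by
    have hc : ContinuousAt (fun t : ℝ => o + t • u) 0 := by fun_prop
    exact hc.preimage_mem_nhds (by simpa using mem_interior_iff_mem_nhds.1 ho)
  obtain ⟨t, htP, ht⟩ := ((hnear.filter_mono nhdsWithin_le_nhds).and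
    (self_mem_nhdsWithin (s := Set.Ioi (0 : ℝ)))).exists
  refine ⟨f.toLinearMap, ?_, hfb⟩
  have h1 := hfb _ htP
  rw [map_add, map_smul, smul_eq_mul] at h1
  have h2 := mul_pos (show 0 < t from ht) hu
  change f o < f b
  linarith

end Radial

/-! ### From the boundary triangulation to a convex fan. -/

variable {P : Set E3} {K : Geometry.SimplicialComplex ℝ E3}

/-- If a point in the relative interior of a face lies in another face, the first face is contained
in the second one. -/
theorem face_subset_of_mem {f g : Finset E3} (hf : f ∈ K.faces) (hg : g ∈ K.faces) {w : E3 → ℝ}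
    (hw : ∀ p ∈ f, 0 < w p) (hw1 : ∑ p ∈ f, w p = 1)
    (hmem : ∑ p ∈ f, w p • p ∈ convexHull ℝ (g : Set E3)) : f ⊆ g := by
  classical
  have h1 : ∑ p ∈ f, w p • p ∈ convexHull ℝ (f : Set E3) :=
    Finset.mem_convexHull'.2 ⟨w, fun p hp => (hw p hp).le, hw1, rfl⟩
  have h2 := K.inter_subset_convexHull hf hg ⟨h1, hmem⟩
  rw [← Finset.coe_inter, Finset.mem_convexHull'] at h2
  obtain ⟨e, -, he1, he⟩ := h2
  intro p hp
  by_contra hpg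
  have := (K.indep hf).eq_of_sum_eq_sum_subtype (w₁ := w)
    (w₂ := fun q => if q ∈ f ∩ g then e q else 0)
    (by rw [hw1, Finset.sum_ite_mem, ← Finset.inter_assoc, Finset.inter_self, he1])
    (by simp only [ite_smul, zero_smul]
        rw [Finset.sum_ite_mem, ← Finset.inter_assoc, Finset.inter_self, he]) p hp
  rw [if_neg (by simp [hpg])] at this
  exact (hw p hp).ne' this

/-- The faces of `K`, as sets of vertices of `P`. -/
def vertexFaces (P : Set E3) (K : Geometry.SimplicialComplex ℝ E3) :
    Set (Finset (P.extremePoints ℝ)) :=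
  {s | s.map (Function.Embedding.subtype _) ∈ K.faces}

/-- Scaling cone coefficients to total 1 projects a point of the open cone radially into the open
simplex. -/
theorem exists_weights {s : Finset (P.extremePoints ℝ)} {o z : E3}
    {c : P.extremePoints ℝ → ℝ} (hs : s.Nonempty) (hc : ∀ p ∈ s, 0 < c p)
    (hz : ∑ p ∈ s, c p • ((p : E3) - o) = z) :
    ∃ (r : ℝ) (w : E3 → ℝ), 0 < r ∧ (∀ p ∈ s.map (Function.Embedding.subtype _), 0 < w p) ∧
      ∑ p ∈ s.map (Function.Embedding.subtype _), w p = 1 ∧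
      ∑ p ∈ s.map (Function.Embedding.subtype _), w p • p = o + r • z := by
  classical
  set C := ∑ p ∈ s, c p with hC
  have hCpos : 0 < C := Finset.sum_pos hc hs
  have hsum : ∑ p ∈ s, C⁻¹ * c p = 1 := by
    rw [← Finset.mul_sum, ← hC, inv_mul_cancel₀ hCpos.ne']
  obtain ⟨w, hw⟩ : ∃ w : E3 → ℝ, ∀ p : P.extremePoints ℝ, w p = C⁻¹ * c p :=
    ⟨fun q => if h : q ∈ P.extremePoints ℝ then C⁻¹ * c ⟨q, h⟩ else 0, fun p => by simp⟩
  refine ⟨C⁻¹, w, inv_pos.2 hCpos, ?_, ?_, ?_⟩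
  · intro q hq
    obtain ⟨p, hp, rfl⟩ := Finset.mem_map.1 hq
    exact (mul_pos (inv_pos.2 hCpos) (hc p hp)).trans_eq (hw p).symm
  · rw [Finset.sum_map, ← hsum]
    exact Finset.sum_congr rfl fun p _ => hw p
  · rw [Finset.sum_map]
    simp only [Function.Embedding.subtype_apply]
    rw [← hz, Finset.smul_sum]
    have : o = ∑ p ∈ s, (C⁻¹ * c p) • o := by rw [← Finset.sum_smul, hsum, one_smul]
    nth_rw 1 [this]
    rw [← Finset.sum_add_distrib]
    exact Finset.sum_congr rfl fun p _ => by rw [hw p]; module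

/-- A triangulation of the boundary of a convex polytope spans a complete convex fan with respect
to an interior point. -/
theorem isConvexFan_vertexFaces [DecidableEq (P.extremePoints ℝ)] (hP : IsConvexPolytope P)
    (hK : IsBoundaryTriangulation K P) {o : E3} (ho : o ∈ interior P) :
    IsConvexFan (fun p : P.extremePoints ℝ => (p : E3) - o) (vertexFaces P K) := by
  classical
  obtain ⟨⟨S, rfl⟩, -⟩ := hP
  set P : Set E3 := convexHull ℝ (S : Set E3) with hPdef
  obtain ⟨hKv, hKs⟩ := hK
  have hconv : Convex ℝ P := convex_convexHull ℝ _
  have hbdd : Bornology.IsBounded P := isBounded_convexHull.2 S.finite_toSet.isBounded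
  have hVP : ∀ p : P.extremePoints ℝ, (p : E3) ∈ P := fun p => p.2.1
  have hnonempty : ∀ s ∈ vertexFaces P K, s.Nonempty := fun s hs =>
    Finset.map_nonempty.1 (K.nonempty_of_mem_faces hs)
  have hfaceV : ∀ f ∈ K.faces, ∀ p ∈ f, p ∈ P.extremePoints ℝ := by
    intro f hf p hp
    rw [← hKv, Geometry.SimplicialComplex.mem_vertices]
    exact K.down_closed hf (by simpa using hp) (by simp)
  have hdown : ∀ s ∈ vertexFaces P K, ∀ t ⊆ s, t.Nonempty → t ∈ vertexFaces P K :=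
    fun s hs t hts ht => K.down_closed hs (Finset.map_subset_map.2 hts) (ht.map)
  have hfront : ∀ s ∈ vertexFaces P K,
      convexHull ℝ ((s.map (Function.Embedding.subtype _) : Finset E3) : Set E3) ⊆ frontier P :=
    fun s hs => hKs ▸ K.convexHull_subset_space hs
  refine ⟨hnonempty, hdown, ?_, ?_, ?_, ?_, ?_⟩
  · intro p
    have h : (p : E3) ∈ K.vertices := by rw [hKv]; exact p.2
    rw [Geometry.SimplicialComplex.mem_vertices] at h
    simpa [vertexFaces] using h
  · intro z hz
    obtain ⟨r, hr, hmem⟩ := exists_smul_mem_frontier hconv hbdd ho hz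
    rw [← hKs, Geometry.SimplicialComplex.mem_space_iff] at hmem
    obtain ⟨f, hf, hmem⟩ := hmem
    obtain ⟨w, hw, hw1, hwz⟩ := Finset.mem_convexHull'.1 hmem
    set s : Finset (P.extremePoints ℝ) := f.subtype (· ∈ P.extremePoints ℝ) with hs
    have hsf : s.map (Function.Embedding.subtype _) = f :=
      Finset.subtype_map_of_mem (hfaceV f hf)
    have hsS : s ∈ vertexFaces P K := by
      change s.map (Function.Embedding.subtype _) ∈ K.faces
      rwa [hsf]
    rw [← hsf, Finset.sum_map] at hw1 hwz
    simp only [Function.Embedding.subtype_apply] at hw1 hwz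
    have hws : ∀ p ∈ s, 0 ≤ w p := fun p hp => hw p (Finset.mem_subtype.1 hp)
    have e : ∀ p : P.extremePoints ℝ, p ∈ s → p ∉ s.filter (fun p : P.extremePoints ℝ => 0 < w p) → w p = 0 := fun p hp hp' =>
      
      le_antisymm (not_lt.1 fun h => hp' (Finset.mem_filter.2 ⟨hp, h⟩)) (hws p hp)
    refine ⟨s.filter (fun p : P.extremePoints ℝ => 0 < w p), hdown s hsS _ (Finset.filter_subset _ _) ?_,
      fun p => r⁻¹ * w p, fun p hp => mul_pos (inv_pos.2 hr) (Finset.mem_filter.1 hp).2, ?_⟩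
    · by_contra hne
      rw [← Finset.sum_subset (Finset.filter_subset (fun p : P.extremePoints ℝ => 0 < w p) s) e,
        Finset.not_nonempty_iff_eq_empty.1 hne, Finset.sum_empty] at hw1
      exact zero_ne_one hw1
    · rw [Finset.sum_subset (Finset.filter_subset _ _) fun p hp hp' => by
        simp [e p hp hp']]
      simp only [mul_smul, smul_sub, Finset.sum_sub_distrib, ← Finset.smul_sum, hwz,
        ← Finset.sum_smul, hw1]
      rw [one_smul, ← smul_sub, add_sub_cancel_left, smul_smul, inv_mul_cancel₀ hr.ne', one_smul]
  · rintro s hs t ht z ⟨c, hc, hcz⟩ ⟨d, hd, hdz⟩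
    obtain ⟨r, w, hr, hw, hw1, hwz⟩ := exists_weights (hnonempty s hs) hc hcz
    obtain ⟨r', w', hr', hw', hw1', hwz'⟩ := exists_weights (hnonempty t ht) hd hdz
    have m : o + r • z ∈ convexHull ℝ ((s.map (Function.Embedding.subtype _) : Finset E3) : Set E3) :=
      Finset.mem_convexHull'.2 ⟨w, fun p hp => (hw p hp).le, hw1, hwz⟩
    have m' : o + r' • z ∈
        convexHull ℝ ((t.map (Function.Embedding.subtype _) : Finset E3) : Set E3) :=
      Finset.mem_convexHull'.2 ⟨w', fun p hp => (hw' p hp).le, hw1', hwz'⟩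
    -- Both projections lie on one ray from `o`, which meets the boundary only once.
    have hrr : r' / r = 1 := by
      refine eq_one_of_smul_mem_frontier hconv ho (div_pos hr' hr) (hfront s hs m) ?_
      rw [smul_smul, div_mul_cancel₀ _ hr.ne']
      exact hfront t ht m'
    rw [div_eq_one_iff_eq hr.ne'] at hrr
    subst hrr
    refine Finset.Subset.antisymm ?_ ?_
    · exact Finset.map_subset_map.1 (face_subset_of_mem hs ht hw hw1 (hwz ▸ m'))
    · exact Finset.map_subset_map.1 (face_subset_of_mem ht hs hw' hw1' (hwz' ▸ m))
  · intro s hs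
    have hcard : (0 : ℝ) < s.card := by exact_mod_cast (hnonempty s hs).card_pos
    -- A maximum over `P` attained at the barycentre of a face is attained at each of its vertices.
    set b : E3 := ∑ p ∈ s, (s.card : ℝ)⁻¹ • (p : E3) with hb
    have hsum1 : ∑ _p ∈ s, (s.card : ℝ)⁻¹ = 1 := by
      rw [Finset.sum_const, nsmul_eq_mul, mul_inv_cancel₀ hcard.ne']
    have hbmem : b ∈ frontier P := by
      refine hfront s hs (Finset.mem_convexHull'.2 ⟨fun _ => (s.card : ℝ)⁻¹,
        fun _ _ => (inv_pos.2 hcard).le, ?_, ?_⟩)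
      · rw [Finset.sum_map]; exact hsum1
      · rw [Finset.sum_map]; rfl
    obtain ⟨f, hfo, hf⟩ := exists_supporting_functional hconv ho hbmem.2
    have hfs : ∀ p : P.extremePoints ℝ, p ∈ s → f p = f b := by
      have h0 : ∑ p ∈ s, (s.card : ℝ)⁻¹ * (f b - f p) = 0 := by
        simp only [mul_sub, Finset.sum_sub_distrib]
        rw [← Finset.sum_mul, hsum1, one_mul]
        nth_rw 1 [hb]
        simp only [map_sum, map_smul, smul_eq_mul, sub_self]
      intro p hp
      have := (Finset.sum_eq_zero_iff_of_nonneg fun (p : P.extremePoints ℝ) _ => mul_nonneg (inv_pos.2 hcard).le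
        (sub_nonneg.2 (hf p (hVP p)))).1 h0 p hp
      rcases mul_eq_zero.1 this with h | h
      · exact absurd h (inv_pos.2 hcard).ne'
      · linarith
    have hpos : 0 < f b - f o := sub_pos.2 hfo
    refine ⟨(f b - f o)⁻¹ • f, fun p hp => ?_, fun p => ?_⟩
    · rw [LinearMap.smul_apply, map_sub, hfs p hp, smul_eq_mul, inv_mul_cancel₀ hpos.ne']
    · rw [LinearMap.smul_apply, map_sub, smul_eq_mul, inv_mul_le_iff₀ hpos]
      linarith [hf p (hVP p)]
  · intro v
    have hvf : (v : E3) ∈ frontier P := by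
      rw [← hKs]; exact K.vertices_subset_space (by rw [hKv]; exact v.2)
    have hvo : (v : E3) ≠ o := fun h => hvf.2 (h ▸ ho)
    have hfin : (P.extremePoints ℝ).Finite :=
      S.finite_toSet.subset extremePoints_convexHull_subset
    -- Including `o` among the separated points yields `g (v - o) < 0`.
    set B : Set E3 := insert o (P.extremePoints ℝ \ {(v : E3)}) with hB
    have hBfin : B.Finite := (hfin.subset Set.sdiff_subset).insert o
    have hBP : convexHull ℝ B ⊆ P := by
      refine convexHull_min ?_ hconv
      rintro q (rfl | hq)
      exacts [interior_subset ho, hq.1.1]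
    have hvB : (v : E3) ∉ convexHull ℝ B := by
      intro h
      rcases extremePoints_convexHull_subset (𝕜 := ℝ) (A := B)
        (inter_extremePoints_subset_extremePoints_of_subset (𝕜 := ℝ) hBP ⟨h, v.2⟩) with h | h
      exacts [hvo h, h.2 rfl]
    obtain ⟨g, u, hgv, hg⟩ := geometric_hahn_banach_point_closed (convex_convexHull ℝ B)
      (hBfin.isCompact_convexHull ℝ).isClosed hvB
    refine ⟨g.toLinearMap, ?_, fun p hp => ?_⟩
    · change g (v - o) < 0
      rw [map_sub]
      linarith [hg o (subset_convexHull ℝ B (Set.mem_insert _ _))]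
    · change g (v - o) < g (p - o)
      rw [map_sub, map_sub]
      linarith [hg p (subset_convexHull ℝ B (Set.mem_insert_of_mem _
        ⟨p.2, fun h => hp (Subtype.ext h)⟩))]

/-! ### Edge lengths and rigid motions to first order. -/

theorem inner_eq_zero_of_hasDerivAt_dist {p q a b : E3}
    (h : HasDerivAt (fun t : ℝ => dist (p + t • a) (q + t • b)) 0 0) :
    inner ℝ (p - q) (a - b) = (0 : ℝ) := by
  have h1 : HasDerivAt (fun t : ℝ => (p - q) + t • (a - b)) (a - b) 0 := by
    simpa using ((hasDerivAt_id (0 : ℝ)).smul_const (a - b)).const_add (p - q)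
  have h2 := h1.norm_sq
  have h3 := h.pow 2
  have e : (fun t : ℝ => ‖(p - q) + t • (a - b)‖ ^ 2) =
      (fun t : ℝ => dist (p + t • a) (q + t • b)) ^ 2 := by
    funext t
    rw [Pi.pow_apply, dist_eq_norm]
    congr 2
    module
  rw [e] at h2
  have := h2.unique h3
  simpa using this

/-- The cross product with a fixed vector as a continuous linear map. -/
noncomputable def crossL (ω : E3) : E3 →L[ℝ] E3 :=
  LinearMap.toContinuousLinearMap
    { toFun := cross ω
      map_add' := cross_add ω
      map_smul' := fun r z => cross_smul r ω z }

@[simp] theorem crossL_apply (ω z : E3) : crossL ω z = cross ω z := rfl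

theorem crossL_mem_skewAdjoint (ω : E3) : crossL ω ∈ skewAdjoint (E3 →L[ℝ] E3) := by
  rw [skewAdjoint.mem_iff, ContinuousLinearMap.star_eq_adjoint]
  symm
  rw [ContinuousLinearMap.eq_adjoint_iff]
  intro a b
  simp only [neg_apply, crossL_apply, inner_neg_left, inner_cross]
  rw [real_inner_comm, inner_cross]
  simp only [det3]
  ring

/-- The exponentials of the skew map `t • crossL ω` are orthogonal; following them by the
translation by `t • τ` gives the required isometries. -/
theorem isInfinitesimalRigidMotion_cross_add (ω τ : E3) :
    IsInfinitesimalRigidMotion fun z => cross ω z + τ := by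
  let : NormedAlgebra ℚ (E3 →L[ℝ] E3) := NormedAlgebra.restrictScalars ℚ ℝ _
  have hU : ∀ t : ℝ, NormedSpace.exp (t • crossL ω) ∈ unitary (E3 →L[ℝ] E3) := fun t =>
    NormedSpace.exp_mem_unitary_of_mem_skewAdjoint
      (skewAdjoint.smul_mem t (crossL_mem_skewAdjoint ω))
  have h0 : NormedSpace.exp ((0 : ℝ) • crossL ω) = 1 := by
    rw [show (0 : ℝ) • crossL ω = 0 from zero_smul ℝ (crossL ω), NormedSpace.exp_zero]
  refine ⟨fun t => (Unitary.linearIsometryEquiv ⟨_, hU t⟩).toAffineIsometryEquiv.trans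
    (AffineIsometryEquiv.constVAdd ℝ E3 (t • τ)), ?_, fun z => ?_⟩
  · ext1 z
    change (0 : ℝ) • τ +ᵥ NormedSpace.exp ((0 : ℝ) • crossL ω) z = z
    rw [h0]
    simp
  · change HasDerivAt (fun t : ℝ => t • τ + NormedSpace.exp (t • crossL ω) z) (cross ω z + τ) 0
    have h1 := hasDerivAt_exp_smul_const (𝕂 := ℝ) (crossL ω) 0
    rw [h0, one_mul] at h1
    have h2 := h1.clm_apply (hasDerivAt_const (0 : ℝ) z)
    have h3 := ((hasDerivAt_id (0 : ℝ)).smul_const τ).add h2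
    refine h3.congr_deriv ?_
    simp [h0, add_comm]

end PolytopeRigidity

/-! ### Conclusion. -/

theorem mainTheorem10
    (P : Set PolytopeRigidity.E3) (hP : PolytopeRigidity.IsConvexPolytope P)
    (K : Geometry.SimplicialComplex ℝ PolytopeRigidity.E3)
    (hK : PolytopeRigidity.IsBoundaryTriangulation K P)
    (v : P.extremePoints ℝ → PolytopeRigidity.E3)
    (hv : PolytopeRigidity.IsFirstOrderFlex K (P.extremePoints ℝ) v) :
    PolytopeRigidity.IsTrivialMotion (P.extremePoints ℝ) v := by
  classical
  obtain ⟨o, ho⟩ := hP.2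
  have hfin : (P.extremePoints ℝ).Finite := by
    obtain ⟨⟨S, rfl⟩, -⟩ := hP
    exact S.finite_toSet.subset extremePoints_convexHull_subset
  have := hfin.fintype
  have F := PolytopeRigidity.isConvexFan_vertexFaces hP hK ho
  obtain ⟨ω, τ, h⟩ := F.exists_infinitesimal_rigid_motion (w := v) (by
    intro p q hpq hs
    have hne : (p : PolytopeRigidity.E3) ≠ q := fun h => hpq (Subtype.ext h)
    rw [sub_sub_sub_cancel_right]
    exact PolytopeRigidity.inner_eq_zero_of_hasDerivAt_dist
      (hv p q ⟨hne, _, hs, by simp⟩))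
  -- The fan is centred at `o`; the shift of `τ` returns to the original origin.
  refine ⟨_, PolytopeRigidity.isInfinitesimalRigidMotion_cross_add ω
    (τ - PolytopeRigidity.cross ω o), fun p => ?_⟩
  rw [h p, PolytopeRigidity.cross_sub]
  abel
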